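/- **Setting.** Let $\mathcal M_k$ be the space of marked groups $(G,S)$, where $S$ is an ordered $k$-tuple generating the group $G$, taken up to isomorphism of marked groups, with the topology generated by the metric $d=2^{-n}$, where $n$ is the largest radius for which the balls about the identity in the (labelled, directed) Cayley graphs are identical. Let $\Omega=\{0,1,2\}^{\mathbb N}$ (sequences $\omega=\omega_1\omega_2\dots$), let $\Omega_0$ be the set of sequences in which all three symbols occur infinitely often, $\Omega_2$ the set of eventually constant sequences, $\Omega_1=\Omega\setminus(\Omega_0\cup\Omega_2)$, and let $\sigma$ be the left shift. On the binary rooted tree with vertices the finite words over $\{0,1\}$, a sequence $(a_n)_{n\ge1}$ with $a_n\in\{P,I\}$ defines the automorphism that swaps the two subtrees below the vertex $1^{n-1}0$ if $a_n=P$, for each $n$, and acts trivially at all other vertices. Let $a$ be the swap of the two subtrees at the root, $x=(P,P,\dots)$, and let $b_\omega,c_\omega,d_\omega$ be given by the sequences whose $n$-th term is $I$ if $\omega_n=2$, $1$, $0$ respectively, and $P$ otherwise. Put $\tilde b_\omega=xb_\omega$, $\tilde c_\omega=xc_\omega$, $\tilde d_\omega=xd_\omega$. The generalized overgroup $\tilde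 G_\omega$ is the group generated by $(a,b_\omega,c_\omega,d_\omega,x,\tilde b_\omega,\tilde c_\omega,\tilde d_\omega)$, as a point of $\mathcal M_8$. Consider words in $a,b,c,d,x,\tilde b,\tilde c,\tilde d$. The simple contractions say that each letter is an involution and that $1,b,c,d,x,\tilde b,\tilde c,\tilde d$ multiply as $(\mathbb Z/2)^3$ with $bc=d$, $\tilde b=xb$, $\tilde c=xc$, $\tilde d=xd$. A word is reduced if no contraction applies. A reduced word $W$ with an even number of $a$'s is a product of elements $y$ and $aya$ with $y\ne a$ a letter; it decomposes coordinatewise into two words, subsequently reduced, $(W_0,W_1)$ by $y\mapsto(p,y)$, $aya\mapsto(y,p)$, where $p=a$ if the first term of the $P/I$-sequence of $y$ (for the oracle $\omega$) is $P$, and $p$ is empty otherwise. Iterate, using $\sigma^m\omega$ at depth $m$. Algorithm $\alpha$ accepts $W$ if it can be decomposed to depth $N=\lceil\log_2|W|\rceil$ ($N=0$ for the empty word), every word met before depth $N$ having an even number of $a$'s, and all $2^N$ words obtained are empty. For $\{i,j,k\}=\{0,1,2\}$ and $\omega$ containing $k$ at most finitely often, with $N_0$ the last index with $\omega_{N_0}=k$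 ($N_0=0$ if there is none), algorithm $\beta_{ij}$ accepts $W$ if it can be decomposed in the same way to depth $N=\max\{N_0,\lceil\log_2|W|\rceil\}$ and all words obtained are empty or equal to $e_{ij}$, where $e_{01}=\tilde b$, $e_{12}=\tilde d$, $e_{20}=\tilde c$. The modified overgroups $\tilde G_\omega^\alpha$ and (for such $\omega$) $\tilde G_\omega^{\beta_{ij}}$ are the points of $\mathcal M_8$ that satisfy the simple contractions and in which a reduced word is the identity if and only if it is accepted by $\alpha$, respectively $\beta_{ij}$. Put $\mathcal X=\{\tilde G_\omega:\omega\in\Omega\}$; $\mathcal X_i=\{\tilde G_\omega:\omega\in\Omega_i\}$ for $i=0,1,2$; $\mathcal X_i^\alpha=\{\tilde G_\omega^\alpha:\omega\in\Omega_i\}$ for $i=1,2$; $\mathcal X_2^\beta=\{\tilde G_\omega^{\beta}:\omega\in\Omega_2,\ \beta\in\{\beta_{01},\beta_{12},\beta_{20}\}\text{ defined for }\omega\}$; and $\mathcal Y=\mathcal X_0\cup\mathcal X_1^\alpha\cup\mathcal X_2^\alpha$. Write $\overline V$ for the closure and $V_\sharp$ for the set of limit points of $V\subseteq\mathcal M_8$.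 **Theorem.** 1. $\overline{\mathcal X}=\mathcal X_\sharp\sqcup\mathcal X_2$ (a disjoint union), and $\mathcal X_2$ is exactly the set of isolated points of $\mathcal X$, and also exactly the set of isolated points of $\overline{\mathcal X}$. 2. $\mathcal X_\sharp$ and $\mathcal Y$ are homeomorphic to the Cantor set. 3. (a) $\mathcal Y=(\mathcal X_0)_\sharp=(\mathcal X_1^\alpha)_\sharp=(\mathcal X_2^\alpha)_\sharp$. (b) $\mathcal X_\sharp=\mathcal Y\cup\mathcal X_1\cup\mathcal X_2^\beta=(\mathcal X_1)_\sharp=(\mathcal X_2^\beta)_\sharp=(\mathcal X_2)_\sharp$. -/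

import Mathlib

open Set Topology

namespace Overgroups

/-! ## The space of marked groups -/

/-- A point of the space of marked groups on `k` generators. A pair `(G, S)`, with `S` an ordered
`k`-tuple generating `G`, is recorded up to isomorphism of marked groups by the kernel of the
homomorphism from the free group on `k` letters onto `G` given by `S`. -/
@[ext] structure MarkedGroup (k : ℕ) where
  ker : Subgroup (FreeGroup (Fin k))
  normal : ker.Normal

namespace MarkedGroup

variable {k : ℕ}

instance (M : MarkedGroup k) : M.ker.Normal := M.normal

/-- The underlying group `G` of a marked group. -/
abbrev Grp (M : MarkedGroup k) : Type := FreeGroup (Fin k) ⧸ M.ker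

/-- The marking: the `i`-th generator. -/
def gen (M : MarkedGroup k) (i : Fin k) : M.Grp := QuotientGroup.mk (FreeGroup.of i)

/-- The subgroup of `G` generated by a `k`-tuple `S`, marked by `S`. -/
def ofTuple {G : Type*} [Group G] (S : Fin k → G) : MarkedGroup k where
  ker := (FreeGroup.lift S).ker
  normal := inferInstance

/-- The ball of radius `n` about the identity in the Cayley graph: elements that are products of
at most `n` generators and inverses of generators. -/
def ball (M : MarkedGroup k) (n : ℕ) : Set M.Grp :=
  {g | ∃ w : FreeGroup (Fin k), w.norm ≤ n ∧ (QuotientGroup.mk w : M.Grp) = g}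

/-- The balls of radius `n` about the identity in the Cayley graphs are identical, that is,
isomorphic as rooted directed graphs with edges `g → g * s_i` labelled by `i`. -/
def SameBall (n : ℕ) (M M' : MarkedGroup k) : Prop :=
  ∃ e : M.ball n ≃ M'.ball n,
    (∀ g : M.ball n, (g : M.Grp) = 1 → (e g : M'.Grp) = 1) ∧
    ∀ (g h : M.ball n) (i : Fin k),
      (g : M.Grp) * M.gen i = h ↔ (e g : M'.Grp) * M'.gen i = e h

open Classical in
/-- The distance `2 ^ (-n)`, where `n` is the largest radius for which the balls are identical. -/
noncomputable def gdist (M M' : MarkedGroup k) : ℝ :=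
  if M = M' then 0 else (2⁻¹ : ℝ) ^ sSup {n : ℕ | SameBall n M M'}

/-- The topology generated by the metric. -/
instance : TopologicalSpace (MarkedGroup k) :=
  TopologicalSpace.generateFrom
    {U | ∃ (M : MarkedGroup k) (r : ℝ), U = {M' | gdist M M' < r}}

end MarkedGroup

/-! ## Oracles -/

/-- Oracles: sequences of symbols `0, 1, 2`. The first symbol is `ω 0`. -/
abbrev Oracle : Type := ℕ → Fin 3

/-- The left shift. -/
def shift (ω : Oracle) : Oracle := fun n => ω (n + 1)

/-- All three symbols occur infinitely often. -/
def Omega0 : Set Oracle := {ω | ∀ s, {n | ω n = s}.Infinite}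

/-- Virtually constant sequences. -/
def Omega2 : Set Oracle := {ω | ∃ s N, ∀ n, N ≤ n → ω n = s}

/-- The other sequences: exactly two symbols occur infinitely often. -/
def Omega1 : Set Oracle := (Omega0 ∪ Omega2)ᶜ

/-! ## Letters

The eight letters `a, b, c, d, x, b~, c~, d~` are numbered `0, 1, …, 7` in this order. With this
numbering the simple contractions say that each letter is an involution, and that the product of
two different letters `y, z`, neither of them `a`, is the letter whose number is the bitwise
exclusive or `y ^^^ z`. -/

/-- Whether the letter `y` other than `a` acts as the swap `P` (`true`) or trivially (`false`) at a
level with symbol `s`. The value at the letter `a` is not used. -/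
def acts (s : Fin 3) (y : Fin 8) : Bool :=
  ![false, s != 2, s != 1, s != 0, true, s == 2, s == 1, s == 0] y

/-! ## Generalized overgroups, acting on the binary rooted tree

Vertices are finite words over `{0, 1}`, written as lists of Booleans. -/

/-- The swap of the two subtrees of the root. -/
def flip : List Bool → List Bool
  | [] => []
  | i :: v => (!i) :: v

/-- The tree automorphism given by a sequence of `P` (`true`) and `I` (`false`): the `n`-th term
acts at the vertex `1 ^ (n - 1) 0`, all other vertices are acted on trivially. -/
def directed : (ℕ → Bool) → List Bool → List Bool
  | _, [] => []
  | p, true :: v => true :: directed (fun n => p (n + 1)) v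
  | p, false :: v => false :: (if p 0 then flip v else v)

theorem flip_involutive : Function.Involutive flip := by
  intro v; cases v <;> simp [flip]

theorem directed_involutive (p : ℕ → Bool) : Function.Involutive (directed p) := by
  intro v
  induction v generalizing p with
  | nil => rfl
  | cons i v ih =>
    cases i
    · by_cases h : p 0 <;> simp [directed, h, flip_involutive v]
    · simp [directed, ih]

/-- The element `a`. -/
def aPerm : Equiv.Perm (List Bool) := flip_involutive.toPerm

/-- The element given by a sequence of `P` and `I`. -/
def dirPerm (p : ℕ → Bool) : Equiv.Perm (List Bool) := (directed_involutive p).toPerm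

/-- The elements `b_ω, c_ω, d_ω, x` (letters `1, 2, 3, 4`). -/
def letterPerm (ω : Oracle) (y : Fin 8) : Equiv.Perm (List Bool) :=
  dirPerm fun n => acts (ω n) y

/-- The generating tuple `a, b_ω, c_ω, d_ω, x, x b_ω, x c_ω, x d_ω`. -/
def overgroupGens (ω : Oracle) : Fin 8 → Equiv.Perm (List Bool) :=
  ![aPerm, letterPerm ω 1, letterPerm ω 2, letterPerm ω 3, letterPerm ω 4,
    letterPerm ω 4 * letterPerm ω 1, letterPerm ω 4 * letterPerm ω 2,
    letterPerm ω 4 * letterPerm ω 3]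

/-- The generalized overgroup of `ω`, as a point of the space of marked groups. -/
def overgroup (ω : Oracle) : MarkedGroup 8 := MarkedGroup.ofTuple (overgroupGens ω)

/-! ## Words and the algorithms -/

/-- Words in the eight letters. -/
abbrev Word : Type := List (Fin 8)

/-- Multiply a reduced word by a letter on the left, using the simple contractions. -/
def push (y : Fin 8) : Word → Word
  | [] => [y]
  | z :: w => if y = z then w else if y = 0 ∨ z = 0 then y :: z :: w else (y ^^^ z) :: w

/-- The reduced form of a word. -/
def reduce (w : Word) : Word := w.foldr push []

/-- The words `W_0` (`i = false`) and `W_1` (`i = true`), not yet reduced, that the embedding `ψ`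
gives for a word with an even number of `a`: each `y` other than `a` decomposes as
`(P or I, y)`, with `P` written as the letter `a`, and each `a y a` as `(y, P or I)`. -/
def sec (s : Fin 3) : Bool → Word → Word
  | _, [] => []
  | i, y :: w =>
    if y = 0 then sec s (!i) w
    else (if i then [y] else if acts s y then [0] else []) ++ sec s i w

/-- Decomposing the reduced word `W` to the depth `n` is possible (every word met on the way has an
even number of `a`), and all the reduced words obtained belong to `E`. -/
def NucleusIn (E : Set Word) : ℕ → Oracle → Word → Prop
  | 0, _, W => W ∈ E
  | n + 1, ω, W => Even (W.count 0) ∧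
      NucleusIn E n (shift ω) (reduce (sec (ω 0) false W)) ∧
      NucleusIn E n (shift ω) (reduce (sec (ω 0) true W))

/-- The reduced word `W` gives a positive result in the algorithm `α`. -/
def AlphaPositive (ω : Oracle) (W : Word) : Prop :=
  NucleusIn {[]} (Nat.clog 2 W.length) ω W

/-- The letter `e_{ij}`, indexed by the missing symbol `k`, `{i, j, k} = {0, 1, 2}`:
`e_{12} = d~`, `e_{20} = c~`, `e_{01} = b~`. -/
def eLetter (k : Fin 3) : Fin 8 := ![7, 6, 5] k

/-- The last position (counted from `1`) of the symbol `k`, or `0` if `k` does not occur. -/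
noncomputable def lastIndex (k : Fin 3) (ω : Oracle) : ℕ := sSup {m | ∃ n, ω n = k ∧ m = n + 1}

/-- The reduced word `W` gives a positive result in the algorithm `β_{ij}`, where
`{i, j, k} = {0, 1, 2}`. -/
def BetaPositive (k : Fin 3) (ω : Oracle) (W : Word) : Prop :=
  NucleusIn {[], [eLetter k]} (max (lastIndex k ω) (Nat.clog 2 W.length)) ω W

/-- The word in the eight letters that spells an element of the free group. (All the generators
are going to be involutions, so exponents do not matter.) -/
def spell (g : FreeGroup (Fin 8)) : Word := g.toWord.map Prod.fst

/-! ### The accepted words form a normal subgroup -/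

theorem xor_cancel (y z : Fin 8) : y ^^^ (y ^^^ z) = z := by revert y z; decide

theorem xor_ne (y z : Fin 8) (h : y ≠ z) : y ^^^ z ≠ 0 := by revert y z; decide

theorem xor_ne_left : ∀ y z : Fin 8, z ≠ 0 → y ≠ y ^^^ z := by decide

theorem xor_ne_right : ∀ y z : Fin 8, y ≠ 0 → y ^^^ z ≠ z := by decide

theorem xor_xor : ∀ y z : Fin 8, (y ^^^ z) ^^^ z = y := by decide

theorem xor_xor' : ∀ z t : Fin 8, (z ^^^ t) ^^^ z = t := by decide

theorem xor_xor'' : ∀ y z : Fin 8, z ^^^ (y ^^^ z) = y := by decide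

theorem xor_assoc' : ∀ y z t : Fin 8, y ^^^ (z ^^^ t) = (y ^^^ z) ^^^ t := by decide

/-- No two neighbours are both `a` or both different from `a`. -/
def IsReduced (w : Word) : Prop := w.IsChain fun y z => y = 0 ↔ z ≠ 0

theorem isReduced_push (y : Fin 8) {w : Word} (hw : IsReduced w) : IsReduced (push y w) := by
  rcases w with _ | ⟨z, w⟩
  · simp [push, IsReduced]
  · simp only [push]
    have hw' : IsReduced w := by
      unfold IsReduced at hw ⊢
      exact hw.tail
    split_ifs with h1 h2
    · exact hw'
    · unfold IsReduced at hw ⊢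
      refine List.IsChain.cons_cons ?_ hw
      rcases h2 with h | h
      · subst h; simp [Ne.symm h1]
      · subst h; simp [h1]
    · push Not at h2
      unfold IsReduced at hw ⊢
      rcases w with _ | ⟨t, w⟩
      · simp
      · have := xor_ne y z h1
        rw [List.isChain_cons_cons] at hw ⊢
        simp_all

theorem isReduced_reduce (w : Word) : IsReduced (reduce w) := by
  induction w with
  | nil => simp [reduce, IsReduced]
  | cons y w ih => exact isReduced_push y ih

theorem push_self (y : Fin 8) {w : Word} (hw : IsReduced w) : push y (push y w) = w := by
  rcases w with _ | ⟨z, w⟩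
  · simp [push]
  · by_cases h1 : y = z
    · subst h1
      rcases w with _ | ⟨t, w⟩
      · simp [push]
      · have h : y = 0 ↔ t ≠ 0 := (List.isChain_cons_cons.1 hw).1
        have : y ≠ t := by rintro rfl; tauto
        simp only [push, if_true, if_neg this]
        rw [if_pos]; tauto
    · by_cases h2 : y = 0 ∨ z = 0
      · simp [push, h1, h2]
      · have h3 : y ≠ y ^^^ z := by
          push Not at h2
          exact xor_ne_left y z h2.2
        have h4 := xor_ne y z h1
        push Not at h2
        simp [push, h1, h2, h3, h4, xor_cancel]

theorem push_push {y z : Fin 8} (hy : y ≠ 0) (hz : z ≠ 0) (h : y ≠ z) {w : Word}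
    (hw : IsReduced w) : push y (push z w) = push (y ^^^ z) w := by
  have h4 := xor_ne y z h
  rcases w with _ | ⟨t, w⟩
  · simp [push, h, hy, hz]
  · by_cases ht : t = 0
    · subst ht
      simp [push, h, hy, hz, h4]
    · by_cases h1 : z = t
      · subst h1
        have h5 : y ^^^ z ≠ z := xor_ne_right y z hy
        have h6 : (y ^^^ z) ^^^ z = y := xor_xor y z
        rcases w with _ | ⟨u, w⟩
        · simp [push, h4, h5, hz, h6]
        · have hu : z = 0 ↔ u ≠ 0 := (List.isChain_cons_cons.1 hw).1
          have hu0 : u = 0 := by by_contra hh; exact hz (hu.2 hh)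
          subst hu0
          simp [push, h4, h5, hz, hy, h6]
      · by_cases h2 : y = z ^^^ t
        · have h3 : y ^^^ z = t := by rw [h2]; exact xor_xor' z t
          simp only [push, if_neg h1, hz, ht, or_self, if_false, if_pos h2, h3, if_true]
        · have h3 : y ^^^ z ≠ t := by
            intro h3; apply h2; rw [← h3]; exact (xor_xor'' y z).symm
          have h5 := xor_ne z t h1
          have h6 : y ^^^ (z ^^^ t) = (y ^^^ z) ^^^ t := xor_assoc' y z t
          simp [push, h1, hz, ht, h2, hy, h5, h3, h4, h6]

/-- Two words with the same reduced form. -/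
def Eqv (u v : Word) : Prop := reduce u = reduce v

theorem reduce_cons (y : Fin 8) (w : Word) : reduce (y :: w) = push y (reduce w) := rfl

theorem reduce_append (u v : Word) : reduce (u ++ v) = u.foldr push (reduce v) := by
  simp [reduce]

theorem Eqv.append_left {v v' : Word} (u : Word) (h : Eqv v v') : Eqv (u ++ v) (u ++ v') := by
  unfold Eqv at *; rw [reduce_append, reduce_append, h]

theorem foldr_reduced (u : Word) {w : Word} (hw : IsReduced w) : IsReduced (u.foldr push w) := by
  induction u with
  | nil => exact hw
  | cons y u ih => exact isReduced_push y ih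

theorem eqv_cancel (y : Fin 8) (w : Word) : Eqv (y :: y :: w) w :=
  push_self y (isReduced_reduce w)

theorem eqv_contract {y z : Fin 8} (hy : y ≠ 0) (hz : z ≠ 0) (h : y ≠ z) (w : Word) :
    Eqv (y :: z :: w) ((y ^^^ z) :: w) :=
  push_push hy hz h (isReduced_reduce w)

/-- A relation on words that is an equivalence, is preserved by adding a letter in front, and
contains the contractions, contains `w ~ reduce w`. -/
theorem rel_reduce (R : Word → Word → Prop) (refl : ∀ w, R w w)
    (trans : ∀ u v w, R u v → R v w → R u w)
    (cons : ∀ y u v, R u v → R (y :: u) (y :: v))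
    (h1 : ∀ y w, R (y :: y :: w) w)
    (h2 : ∀ y z w, y ≠ 0 → z ≠ 0 → y ≠ z → R (y :: z :: w) ((y ^^^ z) :: w))
    (w : Word) : R w (reduce w) := by
  induction w with
  | nil => exact refl _
  | cons y w ih =>
    refine trans _ _ _ (cons y _ _ ih) ?_
    rw [reduce_cons]
    generalize reduce w = v
    rcases v with _ | ⟨z, v⟩
    · exact refl _
    · simp only [push]
      split_ifs with h3 h4
      · subst h3; exact h1 _ _
      · exact refl _
      · push Not at h4
        exact h2 _ _ _ h4.1 h4.2 h3

/-- A map of words that turns contractions into equivalences respects equivalence. -/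
theorem eqv_map (f : Word → Word)
    (hc : ∀ y u v, Eqv (f u) (f v) → Eqv (f (y :: u)) (f (y :: v)))
    (h1 : ∀ y w, Eqv (f (y :: y :: w)) (f w))
    (h2 : ∀ y z w, y ≠ 0 → z ≠ 0 → y ≠ z → Eqv (f (y :: z :: w)) (f ((y ^^^ z) :: w)))
    {u v : Word} (h : Eqv u v) : Eqv (f u) (f v) := by
  have key := rel_reduce (fun u v => Eqv (f u) (f v)) (fun _ => rfl)
    (fun _ _ _ h h' => Eq.trans h h') hc h1 h2
  exact (key u).trans ((congrArg (fun t => reduce (f t)) h).trans (key v).symm)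

theorem eqv_reduce (w : Word) : Eqv w (reduce w) :=
  rel_reduce Eqv (fun _ => rfl) (fun _ _ _ h h' => Eq.trans h h')
    (fun y _ _ h => Eqv.append_left [y] h) eqv_cancel
    (fun _ _ w hy hz h => eqv_contract hy hz h w) w

theorem Eqv.append_right {u u' : Word} (v : Word) (h : Eqv u u') : Eqv (u ++ v) (u' ++ v) :=
  eqv_map (fun w => w ++ v) (fun y _ _ h => Eqv.append_left [y] h)
    (fun y w => eqv_cancel y (w ++ v)) (fun _ _ w hy hz h => eqv_contract hy hz h (w ++ v)) h

theorem Eqv.append {u u' v v' : Word} (h : Eqv u u') (h' : Eqv v v') :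
    Eqv (u ++ v) (u' ++ v') := (h.append_right v).trans (h'.append_left u')

theorem Eqv.reverse {u v : Word} (h : Eqv u v) : Eqv u.reverse v.reverse := by
  refine eqv_map List.reverse ?_ ?_ ?_ h
  · intro y u v h
    simpa using h.append_right [y]
  · intro y w
    have := Eqv.append_left w.reverse (eqv_cancel y [])
    simpa using this
  · intro y z w hy hz h
    have := Eqv.append_left w.reverse (eqv_contract hz hy h.symm [])
    have hx : z ^^^ y = y ^^^ z := by clear hy hz h this; revert y z; decide
    simpa [hx] using this

/-- Parity of the number of `a`. -/
def odd (w : Word) : Bool := w.foldr (fun y p => if y = 0 then !p else p) false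

theorem odd_cons (y : Fin 8) (w : Word) : odd (y :: w) = if y = 0 then !(odd w) else odd w := rfl

theorem even_count (w : Word) : Even (w.count 0) ↔ odd w = false := by
  induction w with
  | nil => simp [odd]
  | cons y w ih =>
    rw [odd_cons]
    by_cases h : y = 0
    · subst h
      rw [List.count_cons_self, Nat.even_add_one, ih]; simp
    · rw [List.count_cons_of_ne h, if_neg h, ih]

theorem odd_append (u v : Word) : odd (u ++ v) = (odd u ^^ odd v) := by
  induction u with
  | nil => simp [odd]
  | cons y u ih =>
    rw [List.cons_append, odd_cons, odd_cons, ih]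
    split_ifs <;> simp

theorem odd_reverse (u : Word) : odd u.reverse = odd u := by
  induction u with
  | nil => rfl
  | cons y u ih =>
    rw [List.reverse_cons, odd_append, ih, odd_cons]
    by_cases h : y = 0 <;> simp [odd, h]

theorem odd_reduce (w : Word) : odd (reduce w) = odd w := by
  refine (rel_reduce (fun u v => odd u = odd v) (fun _ => rfl)
    (fun _ _ _ h h' => h.trans h') ?_ ?_ ?_ w).symm
  · intro y u v h; simp only [odd_cons, h]
  · intro y w; simp only [odd_cons]; split_ifs <;> simp
  · intro y z w hy hz h; simp [odd_cons, hy, hz, xor_ne y z h]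

theorem sec_append (s : Fin 3) (i : Bool) (u v : Word) :
    sec s i (u ++ v) = sec s i u ++ sec s (i ^^ odd u) v := by
  induction u generalizing i with
  | nil => simp [sec, odd]
  | cons y u ih =>
    rw [List.cons_append, sec, sec, odd_cons]
    split_ifs <;> simp [ih]

theorem sec_eqv (s : Fin 3) (i : Bool) {u v : Word} (h : Eqv u v) :
    Eqv (sec s i u) (sec s i v) := by
  have key : ∀ w, ∀ i, Eqv (sec s i w) (sec s i (reduce w)) := by
    refine rel_reduce (fun u v => ∀ i, Eqv (sec s i u) (sec s i v)) (fun _ _ => rfl)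
      (fun _ _ _ h h' i => Eq.trans (h i) (h' i)) ?_ ?_ ?_
    · intro y u v h i
      rw [sec, sec]
      split_ifs
      · exact h _
      all_goals exact Eqv.append_left _ (h _)
    · intro y w i
      have h2 : Eqv (sec s i [y, y]) [] := by
        unfold Eqv; revert s i y; decide
      have h3 : (i ^^ odd [y, y]) = i := by clear h2; revert i y; decide
      have := h2.append_right (sec s i w)
      have h4 := sec_append s i [y, y] w
      rw [h3] at h4
      exact (congrArg reduce h4).trans this
    · intro y z w hy hz h i
      have h2 : Eqv (sec s i [y, z]) (sec s i [y ^^^ z]) := by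
        unfold Eqv; clear w; revert s i y z; decide
      have h3 : (i ^^ odd [y, z]) = i := by simp [odd, hy, hz]
      have h3' : (i ^^ odd [y ^^^ z]) = i := by simp [odd, xor_ne y z h]
      have := h2.append_right (sec s i w)
      have h4 := sec_append s i [y, z] w
      have h4' := sec_append s i [y ^^^ z] w
      rw [h3] at h4
      rw [h3'] at h4'
      exact (congrArg reduce h4).trans (this.trans (congrArg reduce h4').symm)
  exact (key u i).trans ((congrArg (fun t => reduce (sec s i t)) h).trans (key v i).symm)

theorem sec_reverse (s : Fin 3) (i : Bool) (u : Word) :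
    sec s i u.reverse = (sec s (i ^^ odd u) u).reverse := by
  induction u generalizing i with
  | nil => rfl
  | cons y u ih =>
    rw [List.reverse_cons, sec_append, ih, odd_reverse, odd_cons]
    by_cases h : y = 0
    · subst h; simp [sec]
    · simp only [h, if_false, sec, List.append_nil, List.reverse_append]
      congr 1
      split_ifs <;> rfl

theorem count_push_le (y : Fin 8) (w : Word) : (push y w).length ≤ w.length + 1 := by
  rcases w with _ | ⟨z, w⟩
  · simp [push]
  · simp only [push]; split_ifs <;> simp <;> omega

theorem length_reduce_le (w : Word) : (reduce w).length ≤ w.length := by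
  induction w with
  | nil => simp [reduce]
  | cons y w ih =>
    rw [reduce_cons]; exact (count_push_le _ _).trans (by simpa using ih)

theorem length_sec_le (s : Fin 3) {w : Word} (hw : IsReduced w) (i : Bool) :
    2 * (sec s i w).length ≤ w.length + 1 := by
  have key : ∀ n, ∀ w : Word, w.length ≤ n → IsReduced w → ∀ i,
      2 * (sec s i w).length ≤ w.length + 1 := by
    intro n
    induction n using Nat.strong_induction_on with
    | _ n ih =>
      intro w hn hw i
      have hlen : ∀ (y : Fin 8) (i : Bool),
          (if i then [y] else if acts s y then [0] else [] : Word).length ≤ 1 := by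
        intro y i; split_ifs <;> simp
      rcases w with _ | ⟨y, _ | ⟨z, w⟩⟩
      · simp [sec]
      · rw [sec]
        have := hlen y i
        split_ifs with h1
        · simp [sec]
        all_goals simp [sec]
      · have h := (List.isChain_cons_cons.1 hw)
        simp only [List.length_cons] at hn ⊢
        have hw2 : IsReduced w := by
          have := h.2; unfold IsReduced; exact this.tail
        have := fun i => ih w.length (by omega) w le_rfl hw2 i
        by_cases hy : y = 0
        · have hz : z ≠ 0 := h.1.1 hy
          rw [sec, if_pos hy, sec, if_neg hz, List.length_append]
          have h1 := hlen z (!i)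
          have h2 := this (!i)
          omega
        · have hz : z = 0 := by
            by_contra hh; exact hy (h.1.2 hh)
          rw [sec, if_neg hy, sec, if_pos hz, List.length_append]
          have h1 := hlen y i
          have h2 := this (!i)
          omega
  exact key _ w le_rfl hw i

/-- The oracle is admissible for `E` from depth `n` on: the letters in `E` decompose
into words of `E`. -/
structure Adm (E : Set Word) (n : ℕ) (ω : Oracle) : Prop where
  nil : [] ∈ E
  single : ∀ w ∈ E, w ≠ [] → ∃ e : Fin 8, e ≠ 0 ∧ w = [e] ∧ E = {[], [e]} ∧
    ∀ m, n ≤ m → acts (ω m) e = false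

theorem Adm.shift {E : Set Word} {n : ℕ} {ω : Oracle} (h : Adm E (n + 1) ω) :
    Adm E n (shift ω) :=
  ⟨h.nil, fun w hw hn => by
    obtain ⟨e, h1, h2, h3, h4⟩ := h.single w hw hn
    exact ⟨e, h1, h2, h3, fun m hm => h4 (m + 1) (by omega)⟩⟩

theorem Adm.mono {E : Set Word} {n n' : ℕ} {ω : Oracle} (h : Adm E n ω) (hn : n ≤ n') :
    Adm E n' ω :=
  ⟨h.nil, fun w hw hn' => by
    obtain ⟨e, h1, h2, h3, h4⟩ := h.single w hw hn'
    exact ⟨e, h1, h2, h3, fun m hm => h4 m (by omega)⟩⟩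

/-- The nucleus condition at depth `n`, for arbitrary words. -/
def Nuc (E : Set Word) (n : ℕ) (ω : Oracle) (W : Word) : Prop := NucleusIn E n ω (reduce W)

theorem Nuc.congr {E : Set Word} {n : ℕ} {ω : Oracle} {U V : Word} (h : Eqv U V) :
    Nuc E n ω U ↔ Nuc E n ω V := by unfold Nuc; rw [h]

theorem nuc_succ {E : Set Word} {n : ℕ} {ω : Oracle} {W : Word} :
    Nuc E (n + 1) ω W ↔ odd W = false ∧ Nuc E n (shift ω) (sec (ω 0) false W) ∧
      Nuc E n (shift ω) (sec (ω 0) true W) := by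
  unfold Nuc
  rw [NucleusIn, even_count, odd_reduce]
  have h := fun i => sec_eqv (ω 0) i (eqv_reduce W)
  rw [← h false, ← h true]

theorem Nuc.nil {E : Set Word} {ω : Oracle} (h : [] ∈ E) (n : ℕ) : Nuc E n ω [] := by
  induction n generalizing ω with
  | zero => exact h
  | succ n ih => rw [nuc_succ]; exact ⟨rfl, ih, ih⟩

theorem Nuc.append {E : Set Word} {n : ℕ} {ω : Oracle} {U V : Word} {m : ℕ} (hE : Adm E m ω)
    (hU : Nuc E n ω U) (hV : Nuc E n ω V) : Nuc E n ω (U ++ V) := by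
  have mulE : ∀ u ∈ E, ∀ v ∈ E, reduce (u ++ v) ∈ E := by
    intro u hu v hv
    by_cases hun : u = []
    · by_cases hvn : v = []
      · subst hun hvn; exact hE.nil
      · obtain ⟨e, -, rfl, -, -⟩ := hE.single v hv hvn
        subst hun; exact hv
    · obtain ⟨e, -, rfl, h3, -⟩ := hE.single u hu hun
      rw [h3] at hv ⊢
      rcases hv with rfl | hv
      · right; rfl
      · rw [mem_singleton_iff] at hv
        subst hv; left; exact eqv_cancel e []
  clear hE
  induction n generalizing ω U V with
  | zero =>
    have := mulE _ hU _ hV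
    have h : Eqv (U ++ V) (reduce U ++ reduce V) := (eqv_reduce U).append (eqv_reduce V)
    change reduce _ ∈ E
    rw [h]; exact this
  | succ n ih =>
    rw [nuc_succ] at *
    obtain ⟨h1, h2, h3⟩ := hU
    obtain ⟨k1, k2, k3⟩ := hV
    refine ⟨by simp [odd_append, h1, k1], ?_, ?_⟩
    · rw [sec_append, h1]; simpa using ih h2 k2
    · rw [sec_append, h1]; simpa using ih h3 k3

theorem Nuc.reverse {E : Set Word} {n : ℕ} {ω : Oracle} {U : Word} {m : ℕ} (hE : Adm E m ω)
    (hU : Nuc E n ω U) : Nuc E n ω U.reverse := by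
  have invE : ∀ u ∈ E, reduce u.reverse ∈ E := by
    intro u hu
    by_cases hun : u = []
    · subst hun; exact hu
    · obtain ⟨e, -, rfl, h3, -⟩ := hE.single u hu hun
      exact hu
  clear hE
  induction n generalizing ω U with
  | zero =>
    have := invE _ hU
    have h : Eqv U.reverse (reduce U).reverse := (eqv_reduce U).reverse
    change reduce _ ∈ E
    rw [h]; exact this
  | succ n ih =>
    rw [nuc_succ] at *
    obtain ⟨h1, h2, h3⟩ := hU
    refine ⟨by simp [odd_reverse, h1], ?_, ?_⟩
    · rw [sec_reverse, h1]; simpa using ih h2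
    · rw [sec_reverse, h1]; simpa using ih h3

theorem Nuc.single {E : Set Word} {ω : Oracle} {e : Fin 8} (he : e ≠ 0) (h0 : [] ∈ E)
    (h1 : [e] ∈ E) (h : ∀ m, acts (ω m) e = false) (n : ℕ) : Nuc E n ω [e] := by
  induction n generalizing ω with
  | zero => exact h1
  | succ n ih =>
    rw [nuc_succ]
    refine ⟨by simp [odd, he], ?_, ?_⟩
    · simpa [sec, he, h 0] using Nuc.nil h0 n
    · have h3 : Nuc E n (shift ω) [e] := ih fun m => h (m + 1)
      simpa [sec, he] using h3

theorem Nuc.succ {E : Set Word} {n : ℕ} {ω : Oracle} {U : Word} (hE : Adm E n ω)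
    (hU : Nuc E n ω U) : Nuc E (n + 1) ω U := by
  induction n generalizing ω U with
  | zero =>
    rw [Nuc.congr (eqv_reduce U)]
    by_cases hn : reduce U = []
    · rw [hn]; exact Nuc.nil hE.nil _
    · obtain ⟨e, h1, h2, h3, h4⟩ := hE.single _ hU hn
      have hm : reduce U ∈ E := hU
      rw [h2] at hm ⊢
      exact Nuc.single h1 hE.nil hm (fun m => h4 m (Nat.zero_le _)) _
  | succ n ih =>
    rw [nuc_succ] at hU ⊢
    exact ⟨hU.1, ih hE.shift hU.2.1, ih hE.shift hU.2.2⟩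

theorem Nuc.mono {E : Set Word} {n n' : ℕ} {ω : Oracle} {U : Word} (hE : Adm E n ω)
    (hn : n ≤ n') (hU : Nuc E n ω U) : Nuc E n' ω U := by
  induction n', hn using Nat.le_induction with
  | base => exact hU
  | succ m hm ih => exact Nuc.succ (hE.mono hm) ih

theorem Nuc.conj {E : Set Word} {n : ℕ} {ω : Oracle} {U : Word} (hE : Adm E n ω)
    (hU : Nuc E n ω U) (y : Fin 8) : Nuc E (n + 1) ω (y :: (U ++ [y])) := by
  have hA : ∀ {ω : Oracle} {n : ℕ} {U : Word}, Adm E n ω → Nuc E n ω U →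
      Nuc E (n + 1) ω (0 :: (U ++ [0])) := by
    intro ω n U hE hU
    have h := Nuc.succ hE hU
    rw [nuc_succ] at h ⊢
    obtain ⟨h1, h2, h3⟩ := h
    refine ⟨by rw [odd_cons, odd_append, h1]; rfl, ?_, ?_⟩
    · simpa [sec, sec_append] using h3
    · simpa [sec, sec_append] using h2
  by_cases hy : y = 0
  · subst hy; exact hA hE hU
  induction n generalizing ω U with
  | zero =>
    have h : Eqv (y :: (U ++ [y])) U := by
      have hu : Eqv ([y] ++ (U ++ [y])) ([y] ++ (reduce U ++ [y])) :=
        Eqv.append_left [y] ((eqv_reduce U).append_right [y])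
      refine Eq.trans hu (Eq.trans ?_ (eqv_reduce U).symm)
      by_cases hn : reduce U = []
      · rw [hn]; exact eqv_cancel y []
      · obtain ⟨e, h1, h2, -, -⟩ := hE.single _ hU hn
        rw [h2]
        clear hu hE hU h2 hn hA
        revert y e; decide
    rw [Nuc.congr h]
    exact Nuc.succ hE hU
  | succ n ih =>
    have hS := Nuc.succ hE hU
    rw [nuc_succ] at hU hS ⊢
    obtain ⟨h1, h2, h3⟩ := hU
    refine ⟨by rw [odd_cons, odd_append, h1]; simp [hy, odd], ?_, ?_⟩
    · by_cases hs : acts (ω 0) y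
      · simpa [sec, hy, sec_append, h1, hs] using hA hE.shift h2
      · simpa [sec, hy, sec_append, h1, hs] using hS.2.1
    · simpa [sec, hy, sec_append, h1] using ih hE.shift h3

theorem Nuc.short {E : Set Word} {n : ℕ} {ω : Oracle} {W : Word} (h0 : [] ∈ E)
    (hl : (reduce W).length ≤ 1) (h : Nuc E n ω W) : Nuc E 0 ω W := by
  rw [Nuc.congr (eqv_reduce W)] at h
  change reduce W ∈ E
  generalize reduce W = V at *
  rcases V with _ | ⟨y, _ | ⟨z, V⟩⟩
  · exact h0
  · induction n generalizing ω with
    | zero => exact h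
    | succ n ih =>
      rw [nuc_succ] at h
      have hy : y ≠ 0 := by
        rintro rfl
        have := h.1
        revert this; decide
      have h3 := h.2.2
      rw [show sec (ω 0) true [y] = [y] by simp [sec, hy]] at h3
      exact ih h3
  · simp at hl

theorem Nuc.descend {E : Set Word} {n N : ℕ} {ω : Oracle} {W : Word} (h0 : [] ∈ E)
    (hl : (reduce W).length ≤ 2 ^ N) (hn : N ≤ n) (h : Nuc E n ω W) : Nuc E N ω W := by
  induction N generalizing n ω W with
  | zero => exact Nuc.short h0 (by simpa using hl) h
  | succ N ih =>
    obtain ⟨n, rfl⟩ : ∃ n', n = n' + 1 := ⟨n - 1, by omega⟩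
    rw [nuc_succ] at h ⊢
    have hlen : ∀ i, (reduce (sec (ω 0) i W)).length ≤ 2 ^ N := by
      intro i
      rw [sec_eqv (ω 0) i (eqv_reduce W)]
      have h1 := length_reduce_le (sec (ω 0) i (reduce W))
      have h2 := length_sec_le (ω 0) (isReduced_reduce W) i
      rw [pow_succ] at hl
      omega
    exact ⟨h.1, ih (hlen _) (by omega) h.2.1, ih (hlen _) (by omega) h.2.2⟩

/-- The choice of depth made by the algorithms does not matter. -/
theorem nucleusIn_iff {E : Set Word} {N₀ : ℕ} {ω : Oracle} (hE : Adm E N₀ ω) (W : Word) :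
    NucleusIn E (max N₀ (Nat.clog 2 (reduce W).length)) ω (reduce W) ↔
      ∃ n, N₀ ≤ n ∧ Nuc E n ω W := by
  constructor
  · intro h; exact ⟨_, le_max_left _ _, h⟩
  · rintro ⟨n, hn, h⟩
    change Nuc E _ ω W
    rcases le_total n (max N₀ (Nat.clog 2 (reduce W).length)) with h1 | h1
    · exact Nuc.mono (hE.mono hn) h1 h
    · refine Nuc.descend hE.nil ?_ h1 h
      exact (Nat.le_pow_clog (by norm_num) _).trans
        (Nat.pow_le_pow_right (by norm_num) (le_max_right _ _))

/-- The spelling of an unreduced expression. -/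
theorem eqv_spell (L : List (Fin 8 × Bool)) :
    Eqv (spell (FreeGroup.mk L)) (L.map Prod.fst) := by
  have h : FreeGroup.Red L (FreeGroup.reduce L) := FreeGroup.reduce.red
  unfold spell
  rw [FreeGroup.toWord_mk]
  generalize FreeGroup.reduce L = L' at h
  induction h with
  | refl => rfl
  | tail _ hs ih =>
    refine Eq.trans ?_ ih
    cases hs with
    | @not L₁ L₂ y b =>
      simpa using (Eqv.append_left (L₁.map Prod.fst)
        (eqv_cancel y (L₂.map Prod.fst))).symm

theorem eqv_spell_mul (g h : FreeGroup (Fin 8)) :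
    Eqv (spell (g * h)) (spell g ++ spell h) := by
  have := eqv_spell (g.toWord ++ h.toWord)
  rw [← FreeGroup.mul_mk, FreeGroup.mk_toWord, FreeGroup.mk_toWord] at this
  simpa [spell] using this

theorem spell_inv (g : FreeGroup (Fin 8)) : spell g⁻¹ = (spell g).reverse := by
  unfold spell
  rw [FreeGroup.toWord_inv, FreeGroup.invRev, List.map_reverse, List.map_map]
  rfl

/-- The subgroup of the elements of the free group whose reduced spelling is accepted. -/
def nucleusSubgroup (E : Set Word) (N₀ : ℕ) (ω : Oracle) (hE : Adm E N₀ ω) :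
    Subgroup (FreeGroup (Fin 8)) where
  carrier := {g | NucleusIn E (max N₀ (Nat.clog 2 (reduce (spell g)).length)) ω
    (reduce (spell g))}
  one_mem' := (nucleusIn_iff hE _).2 ⟨N₀, le_rfl, Nuc.nil hE.nil _⟩
  mul_mem' := by
    intro g h hg hh
    obtain ⟨n, hn, hg⟩ := (nucleusIn_iff hE _).1 hg
    obtain ⟨m, hm, hh⟩ := (nucleusIn_iff hE _).1 hh
    refine (nucleusIn_iff hE _).2 ⟨max n m, hn.trans (le_max_left _ _), ?_⟩
    rw [Nuc.congr (eqv_spell_mul g h)]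
    exact Nuc.append hE (Nuc.mono (hE.mono hn) (le_max_left _ _) hg)
      (Nuc.mono (hE.mono hm) (le_max_right _ _) hh)
  inv_mem' := by
    intro g hg
    obtain ⟨n, hn, hg⟩ := (nucleusIn_iff hE _).1 hg
    refine (nucleusIn_iff hE _).2 ⟨n, hn, ?_⟩
    rw [spell_inv]
    exact Nuc.reverse hE hg

theorem nucleusSubgroup_normal (E : Set Word) (N₀ : ℕ) (ω : Oracle) (hE : Adm E N₀ ω) :
    (nucleusSubgroup E N₀ ω hE).Normal := by
  have key : ∀ (V : Word) (U : Word), (∃ n, N₀ ≤ n ∧ Nuc E n ω U) →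
      ∃ n, N₀ ≤ n ∧ Nuc E n ω (V ++ (U ++ V.reverse)) := by
    intro V
    induction V with
    | nil => intro U h; simpa using h
    | cons y V ih =>
      intro U h
      obtain ⟨n, hn, h⟩ := ih U h
      refine ⟨n + 1, by omega, ?_⟩
      simpa using Nuc.conj (hE.mono hn) h y
  refine ⟨fun g hg h => ?_⟩
  refine (nucleusIn_iff hE _).2 ?_
  obtain ⟨n, hn, hh⟩ := key (spell h) (spell g) ((nucleusIn_iff hE _).1 hg)
  refine ⟨n, hn, ?_⟩
  rw [mul_assoc, Nuc.congr (eqv_spell_mul h (g * h⁻¹))]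
  have := Eqv.append_left (spell h) (eqv_spell_mul g h⁻¹)
  rw [spell_inv] at this
  exact (Nuc.congr this).2 hh

theorem adm_alpha (ω : Oracle) : Adm {[]} 0 ω :=
  ⟨rfl, fun _ hw hn => absurd hw hn⟩

theorem adm_beta {k : Fin 3} {ω : Oracle} (h : {n | ω n = k}.Finite) :
    Adm {[], [eLetter k]} (lastIndex k ω) ω := by
  refine ⟨Or.inl rfl, ?_⟩
  rintro w (hw | hw) hn
  · exact absurd hw hn
  · refine ⟨eLetter k, by clear h hw; revert k; decide, hw, rfl, fun m hm => ?_⟩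
    have hm' : ω m ≠ k := by
      intro hk
      have hb : BddAbove {m | ∃ n, ω n = k ∧ m = n + 1} := by
        refine ((h.image (· + 1)).subset ?_).bddAbove
        rintro _ ⟨n, hn, rfl⟩
        exact ⟨n, hn, rfl⟩
      have : m + 1 ≤ lastIndex k ω := le_csSup hb ⟨m, hk, rfl⟩
      omega
    generalize ω m = s at hm'
    clear h hm hw
    revert s k; decide

/-! ## Modified overgroups -/

/-- The modified overgroup of `ω` for the algorithm `α`: a word in the generators is the identity
iff its reduced form gives a positive result. -/
def alphaOvergroup (ω : Oracle) : MarkedGroup 8 where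
  ker :=
    { nucleusSubgroup {[]} 0 ω (adm_alpha ω) with
      carrier := {g | AlphaPositive ω (reduce (spell g))} }
  normal := nucleusSubgroup_normal {[]} 0 ω (adm_alpha ω)

/-- The modified overgroup of `ω` for the algorithm `β_{ij}`, `{i, j, k} = {0, 1, 2}`, defined when
`k` occurs at most finitely often in `ω`: a word in the generators is the identity iff its reduced
form gives a positive result. -/
noncomputable def betaOvergroup (k : Fin 3) (ω : Oracle) (h : {n | ω n = k}.Finite) : MarkedGroup 8 where
  ker :=
    { nucleusSubgroup {[], [eLetter k]} (lastIndex k ω) ω (adm_beta h) with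
      carrier := {g | BetaPositive k ω (reduce (spell g))} }
  normal := nucleusSubgroup_normal {[], [eLetter k]} (lastIndex k ω) ω (adm_beta h)

/-! ## The sets of marked groups -/

/-- All generalized overgroups. -/
def X : Set (MarkedGroup 8) := range overgroup

/-- Generalized overgroups with oracle in `Omega0`. -/
def X0 : Set (MarkedGroup 8) := overgroup '' Omega0

/-- Generalized overgroups with oracle in `Omega1`. -/
def X1 : Set (MarkedGroup 8) := overgroup '' Omega1

/-- Generalized overgroups with oracle in `Omega2`. -/
def X2 : Set (MarkedGroup 8) := overgroup '' Omega2

/-- The groups modified by `α` with oracle in `Omega1`. -/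
def X1alpha : Set (MarkedGroup 8) := alphaOvergroup '' Omega1

/-- The groups modified by `α` with oracle in `Omega2`. -/
def X2alpha : Set (MarkedGroup 8) := alphaOvergroup '' Omega2

/-- The groups modified by `β_{01}`, `β_{12}` or `β_{20}` with oracle in `Omega2`. -/
def X2beta : Set (MarkedGroup 8) :=
  {M | ∃ (k : Fin 3) (ω : Oracle) (h : {n | ω n = k}.Finite),
    ω ∈ Omega2 ∧ M = betaOvergroup k ω h}

def Y : Set (MarkedGroup 8) := X0 ∪ X1alpha ∪ X2alpha

/-- The isolated points of a subset of a topological space. -/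
def isolatedPoints {T : Type*} [TopologicalSpace T] (A : Set T) : Set T :=
  {p | p ∈ A ∧ ∃ U : Set T, IsOpen U ∧ U ∩ A = {p}}

end Overgroups

/-! All groups of the theorem belong to one family. For an oracle `ω` and a nonempty set `T` of
symbols that eventually contains every `ω i`, let a word be trivial when at all large depths it
decomposes into empty words and letters silent on `T` (`Triv`). The set `T` behaves like symbols
placed at the end of the oracle. The choice `T = univ` gives algorithm α, `T = {k}ᶜ` gives the β
that omits `k`, and `T = limSymbols ω` gives the overgroup itself. Hence `Y` is the part of the
family with `T = univ`, `X2` the part with `|T| = 1`, and `Y ∪ X1 ∪ X2beta` the part with `|T| ≥ 2`.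

Decomposition halves lengths, so triviality of words of length at most `2 ^ m` depends only on the
first `m` symbols and on the set `T ∪ tailSymbols ω m` (`triv_agree`). Along an ultrafilter these
finite data converge, and their limits come from an admissible pair whose set contains the
approximating sets (`exists_ultrafilter_limit`). This makes every part given by an upward closed
condition on `T` compact. A limit with `|T| = 1` determines the whole oracle from a finite amount of
data, so the points of `X2` are isolated.

Conversely, a prefix of `ω`, a block that lists `T`, and a free tail can be spliced into oracles
whose groups approach any given one (`exists_splice`). Two families of words show that the
approximants differ from the limit: commutators separate `|T| ≥ 2` from `|T| = 1`
(`not_triv_commWord`, `triv_commWord_of_const`), and fourth powers detect single symbols when `|T| ≥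
2` (`triv_quartic_silentLetter`). Thus `Y` and the part with `|T| ≥ 2` are compact and perfect. They
embed in a Cantor cube, so Brouwer's characterization makes them Cantor sets. -/

namespace Overgroups

/-! ### The topology of marked groups as pointwise convergence of kernels -/

namespace MarkedGroup

variable {k : ℕ}

/-- The kernels of two marked groups have the same elements of norm at most `n`. -/
def AgreeUpTo (n : ℕ) (M M' : MarkedGroup k) : Prop :=
  ∀ g : FreeGroup (Fin k), g.norm ≤ n → (g ∈ M.ker ↔ g ∈ M'.ker)

theorem AgreeUpTo.mono {m n : ℕ} {M M' : MarkedGroup k} (h : AgreeUpTo n M M') (hm : m ≤ n) :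
    AgreeUpTo m M M' := fun g hg => h g (hg.trans hm)

theorem eq_of_agreeUpTo {M M' : MarkedGroup k} (h : ∀ n, AgreeUpTo n M M') : M = M' :=
  MarkedGroup.ext (Subgroup.ext fun g => h _ g le_rfl)

theorem mk_eq_mk_iff (M : MarkedGroup k) (u v : FreeGroup (Fin k)) :
    (QuotientGroup.mk u : M.Grp) = QuotientGroup.mk v ↔ u⁻¹ * v ∈ M.ker := QuotientGroup.eq

/-- An edge `g * s_i = h` inside the ball of radius `n` is a relation of length at most `(n + 1) +
n`, which accounts for `2 * n + 1`. -/
theorem sameBall_of_agreeUpTo {n : ℕ} {M M' : MarkedGroup k} (h : AgreeUpTo (2 * n + 1) M M') :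
    SameBall n M M' := by
  have key : ∀ u v : FreeGroup (Fin k), u.norm ≤ n + 1 → v.norm ≤ n →
      ((QuotientGroup.mk u : M.Grp) = QuotientGroup.mk v ↔
        (QuotientGroup.mk u : M'.Grp) = QuotientGroup.mk v) := by
    intro u v hu hv
    rw [mk_eq_mk_iff, mk_eq_mk_iff]
    refine h _ ((FreeGroup.norm_mul_le _ _).trans ?_)
    rw [FreeGroup.norm_inv_eq]
    omega
  have rep : ∀ g : M.ball n, ∃ w : FreeGroup (Fin k), w.norm ≤ n ∧
    (QuotientGroup.mk w : M.Grp) = g := fun g => g.2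
  choose r hr hrg using rep
  have hbij : Function.Bijective
      (fun g : M.ball n => (⟨QuotientGroup.mk (r g), r g, hr g, rfl⟩ : M'.ball n)) := by
    constructor
    · intro g g' hg
      have := (key _ _ ((hr g).trans n.le_succ) (hr g')).2 (congrArg Subtype.val hg)
      exact Subtype.ext ((hrg g).symm.trans (this.trans (hrg g')))
    · rintro ⟨_, w, hw, rfl⟩
      let g : M.ball n := ⟨QuotientGroup.mk w, w, hw, rfl⟩
      exact ⟨g, Subtype.ext ((key _ _ ((hr g).trans n.le_succ) hw).1 (hrg g))⟩
  refine ⟨Equiv.ofBijective _ hbij, ?_, ?_⟩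
  · intro g hg
    refine (key (r g) 1 ((hr g).trans n.le_succ) (by simp)).1 ((hrg g).trans hg)
  · intro g g' i
    have hn : (r g * FreeGroup.of i).norm ≤ n + 1 :=
      (FreeGroup.norm_mul_le _ _).trans (by rw [FreeGroup.norm_of]; exact Nat.succ_le_succ (hr g))
    have := key _ _ hn (hr g')
    rw [hrg g', QuotientGroup.mk_mul, QuotientGroup.mk_mul, hrg g] at this
    exact this

/-- A rooted isomorphism of labelled balls must follow labelled paths from the identity, so it sends
the class of a word of length at most `n` to the class of the same word. Injectivity then transfers
triviality. -/
theorem SameBall.agreeUpTo {n : ℕ} {M M' : MarkedGroup k} (h : SameBall n M M') :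
    AgreeUpTo n M M' := by
  obtain ⟨e, h1, hedge⟩ := h
  have mem : ∀ (M : MarkedGroup k) (L : List (Fin k × Bool)), L.length ≤ n →
      (QuotientGroup.mk (FreeGroup.mk L) : M.Grp) ∈ M.ball n := fun M L hL =>
    ⟨_, FreeGroup.norm_mk_le.trans hL, rfl⟩
  have key : ∀ (L : List (Fin k × Bool)) (hL : L.length ≤ n),
      (e ⟨_, mem M L hL⟩ : M'.Grp) = QuotientGroup.mk (FreeGroup.mk L) := by
    intro L
    induction L using List.reverseRecOn with
    | nil => intro hL; exact h1 _ rfl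
    | append_singleton L p ih =>
      intro hL
      have hL' : L.length ≤ n := by
        rw [List.length_append] at hL; omega
      obtain ⟨i, b⟩ := p
      specialize ih hL'
      cases b
      -- For an inverse letter the edge is read backwards, from the endpoint of the longer path.
      · have h2 : ∀ M : MarkedGroup k,
            (QuotientGroup.mk (FreeGroup.mk (L ++ [(i, false)])) : M.Grp) * M.gen i =
              QuotientGroup.mk (FreeGroup.mk L) := by
          intro M
          rw [← FreeGroup.mul_mk, QuotientGroup.mk_mul, gen,
            show FreeGroup.mk [(i, false)] = (FreeGroup.of i)⁻¹ from rfl,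
            QuotientGroup.mk_inv, inv_mul_cancel_right]
        have h3 := (hedge ⟨_, mem M _ hL⟩ ⟨_, mem M _ hL'⟩ i).1 (h2 M)
        rw [ih, ← h2 M'] at h3
        exact mul_right_cancel h3
      · have h2 : ∀ M : MarkedGroup k,
            (QuotientGroup.mk (FreeGroup.mk L) : M.Grp) * M.gen i =
              QuotientGroup.mk (FreeGroup.mk (L ++ [(i, true)])) := by
          intro M
          rw [← FreeGroup.mul_mk, QuotientGroup.mk_mul]; rfl
        have h3 := (hedge ⟨_, mem M _ hL'⟩ ⟨_, mem M _ hL⟩ i).1 (h2 M)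
        rw [ih, h2 M'] at h3
        exact h3.symm
  intro g hg
  have hk := key g.toWord hg
  have hnil := key [] (Nat.zero_le _)
  simp only [FreeGroup.mk_toWord] at hk
  rw [← QuotientGroup.eq_one_iff (N := M.ker), ← QuotientGroup.eq_one_iff (N := M'.ker), ← hk]
  constructor
  · intro h; exact h1 _ h
  · intro h
    have h4 : (e ⟨_, mem M [] (Nat.zero_le _)⟩ : M'.Grp) = 1 := hnil
    have := congrArg Subtype.val (e.injective (Subtype.ext (h.trans h4.symm)))
    exact this

theorem SameBall.symm {n : ℕ} {M M' : MarkedGroup k} (h : SameBall n M M') : SameBall n M' M := by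
  have hA := h.agreeUpTo
  obtain ⟨e, h1, h2⟩ := h
  refine ⟨e.symm, ?_, ?_⟩
  · intro g hg
    have h3 : (1 : M.Grp) ∈ M.ball n := ⟨1, by simp, rfl⟩
    have : e ⟨1, h3⟩ = g := Subtype.ext ((h1 ⟨1, h3⟩ rfl).trans hg.symm)
    rw [← this, Equiv.symm_apply_apply]
  · intro g g' i
    have := h2 (e.symm g) (e.symm g') i
    simpa using this.symm

theorem SameBall.trans {n : ℕ} {M M' M'' : MarkedGroup k} (h : SameBall n M M')
    (h' : SameBall n M' M'') : SameBall n M M'' := by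
  obtain ⟨e, h1, h2⟩ := h
  obtain ⟨e', h1', h2'⟩ := h'
  exact ⟨e.trans e', fun g hg => h1' _ (h1 g hg), fun g g' i =>
    (h2 g g' i).trans (h2' (e g) (e g') i)⟩

theorem exists_not_agreeUpTo {M M' : MarkedGroup k} (h : M ≠ M') : ∃ N, ¬ AgreeUpTo N M M' := by
  by_contra! hN
  exact h (eq_of_agreeUpTo hN)

/-- Bounds the set of radii in `gdist` for distinct groups, so that its `sSup` is not the default
value of an unbounded set. -/
theorem SameBall.lt {M M' : MarkedGroup k} {N n : ℕ} (h : SameBall n M M')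
    (hN : ¬ AgreeUpTo N M M') : n < N := by
  by_contra! hn
  exact hN (h.agreeUpTo.mono hn)

open Classical in
/-- The kernel of a marked group, as a point of a Cantor cube. -/
noncomputable def kerIndicator (M : MarkedGroup k) : FreeGroup (Fin k) → Bool :=
  fun g => decide (g ∈ M.ker)

theorem kerIndicator_eq_iff {M M' : MarkedGroup k} {g : FreeGroup (Fin k)} :
    M.kerIndicator g = M'.kerIndicator g ↔ (g ∈ M.ker ↔ g ∈ M'.ker) := by
  simp [kerIndicator]

theorem kerIndicator_injective : Function.Injective (kerIndicator (k := k)) := fun _ _ h =>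
  MarkedGroup.ext (Subgroup.ext fun g => kerIndicator_eq_iff.1 (congrFun h g))

theorem finite_norm_le (n : ℕ) : {g : FreeGroup (Fin k) | g.norm ≤ n}.Finite :=
  Set.Finite.of_finite_image ((List.finite_length_le (Fin k × Bool) n).subset
    (by rintro _ ⟨g, hg, rfl⟩; exact hg)) FreeGroup.toWord_injective.injOn

theorem isOpen_induced_agreeUpTo (n : ℕ) (M : MarkedGroup k) :
    IsOpen[TopologicalSpace.induced kerIndicator inferInstance] {M' | AgreeUpTo n M M'} := by
  let _ : TopologicalSpace (MarkedGroup k) := TopologicalSpace.induced kerIndicator inferInstance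
  have hc : Continuous (kerIndicator (k := k)) := continuous_induced_dom
  have : {M' | AgreeUpTo n M M'} = ⋂ g ∈ {g : FreeGroup (Fin k) | g.norm ≤ n},
      (fun M' : MarkedGroup k => M'.kerIndicator g) ⁻¹' {M.kerIndicator g} := by
    ext M'
    simp only [AgreeUpTo, mem_ofPred_eq, mem_iInter, mem_preimage, mem_singleton_iff,
      kerIndicator_eq_iff]
    exact forall₂_congr fun _ _ => Iff.comm
  rw [this]
  exact (finite_norm_le n).isOpen_biInter fun g _ =>
    (isOpen_discrete {M.kerIndicator g}).preimage ((continuous_apply g).comp hc)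

/-- A `gdist`-ball of radius `2 ^ (-|g|)` decides membership of `g` in the kernel, so the indicator
is continuous. In the other direction, the generating sets are open for pointwise convergence: near
`M` the distance to `M` is small, and away from `M` it is locally constant. -/
theorem isInducing_kerIndicator : IsInducing (kerIndicator (k := k)) := by
  constructor
  apply le_antisymm
  · rw [← continuous_iff_le_induced, continuous_pi_iff]
    intro g
    rw [continuous_discrete_rng]
    intro b
    have : ∀ M : MarkedGroup k, M.kerIndicator g = b →
        ∃ U, IsOpen U ∧ M ∈ U ∧ ∀ M' ∈ U, M'.kerIndicator g = b := by
      rintro M rfl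
      refine ⟨{M' | gdist M M' < (2⁻¹ : ℝ) ^ g.norm},
        TopologicalSpace.isOpen_generateFrom_of_mem ⟨M, _, rfl⟩, by simp [gdist], ?_⟩
      intro M' hM'
      simp only [mem_ofPred_eq, gdist] at hM'
      split_ifs at hM' with h
      · rw [h]
      · rw [pow_lt_pow_iff_right_of_lt_one₀ (by norm_num) (by norm_num)] at hM'
        -- If no radius worked, the supremum would be `0`, which cannot exceed `g.norm`.
        have hne : {n : ℕ | SameBall n M M'}.Nonempty := by
          by_contra hn
          rw [not_nonempty_iff_eq_empty] at hn
          rw [hn] at hM'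
          simp at hM'
        obtain ⟨n, hn, hlt⟩ := exists_lt_of_lt_csSup hne hM'
        exact (kerIndicator_eq_iff.2 (hn.agreeUpTo g hlt.le)).symm
    rw [isOpen_iff_forall_mem_open]
    intro M hM
    obtain ⟨U, hU, hMU, h⟩ := this M hM
    exact ⟨U, h, hU, hMU⟩
  · refine le_generateFrom ?_
    rintro _ ⟨M, r, rfl⟩
    let _ : TopologicalSpace (MarkedGroup k) := TopologicalSpace.induced kerIndicator inferInstance
    refine isOpen_iff_forall_mem_open.2 fun M' hM' => ?_
    suffices ∃ n, ∀ M'', AgreeUpTo n M' M'' → gdist M M'' < r by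
      obtain ⟨n, hn⟩ := this
      exact ⟨_, hn, isOpen_induced_agreeUpTo n M', fun g _ => Iff.rfl⟩
    simp only [mem_ofPred_eq] at hM'
    by_cases h : M = M'
    · subst h
      have hr : 0 < r := by simpa [gdist] using hM'
      obtain ⟨n, hn⟩ := exists_pow_lt_of_lt_one hr (by norm_num : (2⁻¹ : ℝ) < 1)
      refine ⟨2 * n + 1, fun M'' hA => ?_⟩
      unfold gdist
      split_ifs with h
      · exact hr
      · refine lt_of_le_of_lt (pow_le_pow_of_le_one (by norm_num) (by norm_num) ?_) hn
        obtain ⟨N, hN⟩ := exists_not_agreeUpTo h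
        exact le_csSup ⟨N, fun m hm => (SameBall.lt hm hN).le⟩ (sameBall_of_agreeUpTo hA)
    · obtain ⟨N, hN⟩ := exists_not_agreeUpTo h
      refine ⟨2 * N + 1, fun M'' hA => ?_⟩
      -- All radii shared with `M` lie below `N`, and up to `N` the balls of `M'` and `M''`
      -- coincide. So `M'` and `M''` have the same distance to `M`.
      have hs : ∀ n ≤ N, (SameBall n M M' ↔ SameBall n M M'') := fun n hn => by
        have := sameBall_of_agreeUpTo (hA.mono (by omega : 2 * n + 1 ≤ 2 * N + 1))
        exact ⟨fun h => h.trans this, fun h => h.trans this.symm⟩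
      have hN' : ¬ AgreeUpTo N M M'' := fun h3 =>
        hN fun g hg => (h3 g hg).trans (hA g (by omega)).symm
      have h' : M ≠ M'' := by
        rintro rfl
        exact hN' fun _ _ => Iff.rfl
      have hset : {n : ℕ | SameBall n M M''} = {n : ℕ | SameBall n M M'} := by
        ext n
        exact ⟨fun hn => (hs n (SameBall.lt hn hN').le).2 hn,
          fun hn => (hs n (SameBall.lt hn hN).le).1 hn⟩
      unfold gdist at hM' ⊢
      rw [if_neg h] at hM'
      rwa [if_neg h', hset]

theorem isEmbedding_kerIndicator : IsEmbedding (kerIndicator (k := k)) :=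
  ⟨isInducing_kerIndicator, kerIndicator_injective⟩

instance : T2Space (MarkedGroup k) := isEmbedding_kerIndicator.t2Space

theorem isOpen_agreeUpTo (n : ℕ) (M : MarkedGroup k) : IsOpen {M' | AgreeUpTo n M M'} := by
  rw [isInducing_kerIndicator.eq_induced]
  exact isOpen_induced_agreeUpTo n M

/-- The neighbourhood basis through which the approximation and limit arguments use the topology, in
place of the metric. -/
theorem mem_nhds_iff_agreeUpTo {M : MarkedGroup k} {U : Set (MarkedGroup k)} :
    U ∈ 𝓝 M ↔ ∃ n, {M' | AgreeUpTo n M M'} ⊆ U := by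
  constructor
  · intro hU
    rw [isInducing_kerIndicator.nhds_eq_comap, Filter.mem_comap] at hU
    obtain ⟨V, hV, hVU⟩ := hU
    rw [nhds_pi, Filter.mem_pi] at hV
    obtain ⟨I, hI, t, ht, hIt⟩ := hV
    obtain ⟨n, hn⟩ := (hI.image FreeGroup.norm).bddAbove
    refine ⟨n, fun M' hM' => hVU (hIt fun g hg => ?_)⟩
    have := kerIndicator_eq_iff.2 (hM' g (hn (mem_image_of_mem _ hg)))
    rw [← this]
    exact mem_of_mem_nhds (ht g)
  · rintro ⟨n, hn⟩
    exact Filter.mem_of_superset ((isOpen_agreeUpTo n M).mem_nhds fun g _ => Iff.rfl) hn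

end MarkedGroup

/-! ## Brouwer's characterization of the Cantor set -/

section Brouwer

variable {α : Type*} (f : α → ℕ → Bool)

/-- The points whose first `n` coordinates are those of `x`. -/
def cyl (n : ℕ) (x : α) : Set α := {y | ∀ i < n, f y i = f x i}

variable {f}

theorem cyl_eq_of_mem {n : ℕ} {x y : α} (h : y ∈ cyl f n x) : cyl f n y = cyl f n x := by
  ext z
  exact forall₂_congr fun i hi => by rw [h i hi]

theorem cyl_anti {m n : ℕ} (h : m ≤ n) (x : α) : cyl f n x ⊆ cyl f m x :=
  fun _ hy i hi => hy i (hi.trans_le h)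

theorem mem_cyl_self (n : ℕ) (x : α) : x ∈ cyl f n x := fun _ _ => rfl

theorem mem_cyl_succ {n : ℕ} {x y : α} (h : y ∈ cyl f n x) (h' : f y n = f x n) :
    y ∈ cyl f (n + 1) x := by
  intro i hi
  rcases (Nat.lt_succ_iff_lt_or_eq.1 hi) with hi | rfl
  · exact h i hi
  · exact h'

variable (f) in
/-- The cylinder of depth `n` about `x` contains points with both values of the coordinate `n`. -/
def Branches (x : α) (n : ℕ) : Prop := ∀ b, ∃ y ∈ cyl f n x, f y n = b

theorem branches_congr {n : ℕ} {x y : α} (h : y ∈ cyl f n x) :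
    Branches f y n ↔ Branches f x n := by
  unfold Branches; rw [cyl_eq_of_mem h]

/-- With only two values available, a coordinate that does not branch is constant on the cylinder.
-/
theorem eq_of_not_branches {n : ℕ} {x y : α} (h : ¬ Branches f x n) (hy : y ∈ cyl f n x) :
    f y n = f x n := by
  by_contra hne
  refine h fun b => ?_
  by_cases hb : f x n = b
  · exact ⟨x, mem_cyl_self n x, hb⟩
  · refine ⟨y, hy, ?_⟩
    revert hne hb
    generalize f y n = p
    generalize f x n = q
    revert p q b
    decide

open Classical in
/-- The first branching coordinate from `n` on (if there is one). -/
noncomputable def nextBranch (hb : ∀ x n, ∃ m, n ≤ m ∧ Branches f x m) (x : α) (n : ℕ) : ℕ :=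
  Nat.find (hb x n)

/-- The `k`-th branching coordinate. -/
noncomputable def branchIndex (hb : ∀ x n, ∃ m, n ≤ m ∧ Branches f x m) (x : α) : ℕ → ℕ
  | 0 => nextBranch hb x 0
  | k + 1 => nextBranch hb x (branchIndex hb x k + 1)

variable (hb : ∀ x n, ∃ m, n ≤ m ∧ Branches f x m)

open Classical in
theorem le_nextBranch (x : α) (n : ℕ) : n ≤ nextBranch hb x n := (Nat.find_spec (hb x n)).1

open Classical in
theorem branches_nextBranch (x : α) (n : ℕ) : Branches f x (nextBranch hb x n) :=
  (Nat.find_spec (hb x n)).2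

open Classical in
theorem not_branches_of_lt {x : α} {m n : ℕ} (h : m < nextBranch hb x n) (hn : n ≤ m) :
    ¬ Branches f x m := fun h' => Nat.find_min (hb x n) h ⟨hn, h'⟩

theorem mem_cyl_nextBranch {x y : α} {n : ℕ} (h : y ∈ cyl f n x) :
    y ∈ cyl f (nextBranch hb x n) x := by
  have : ∀ m, n ≤ m → m ≤ nextBranch hb x n → y ∈ cyl f m x := by
    intro m hm
    induction m, hm using Nat.le_induction with
    | base => exact fun _ => h
    | succ m hm ih =>
      intro hlt
      have := ih (by omega)
      exact mem_cyl_succ this (eq_of_not_branches (not_branches_of_lt hb hlt hm) this)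
  exact this _ (le_nextBranch hb x n) le_rfl

open Classical in
theorem nextBranch_congr {x y : α} {n : ℕ} (h : y ∈ cyl f (nextBranch hb x n) x) :
    nextBranch hb y n = nextBranch hb x n := by
  refine (Nat.find_eq_iff _).2 ⟨⟨le_nextBranch hb x n, ?_⟩, ?_⟩
  · exact (branches_congr h).2 (branches_nextBranch hb x n)
  · rintro m hm ⟨h1, h2⟩
    exact not_branches_of_lt hb hm h1 ((branches_congr (cyl_anti hm.le x h)).1 h2)

theorem branchIndex_strictMono (x : α) : StrictMono (branchIndex hb x) :=
  strictMono_nat_of_lt_succ fun _ => le_nextBranch hb x _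

theorem branches_branchIndex (x : α) (k : ℕ) : Branches f x (branchIndex hb x k) := by
  cases k <;> exact branches_nextBranch hb x _

/-- Whether a coordinate branches depends only on the coordinates before it. Hence the code below is
locally constant in each entry. -/
theorem branchIndex_congr {x y : α} {k : ℕ} (h : y ∈ cyl f (branchIndex hb x k) x) :
    branchIndex hb y k = branchIndex hb x k := by
  induction k with
  | zero => exact nextBranch_congr hb h
  | succ k ih =>
    have h1 := ih (cyl_anti ((branchIndex_strictMono hb x).monotone k.le_succ) x h)
    rw [branchIndex, h1]
    exact nextBranch_congr hb h

/-- The values of the branching coordinates. -/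
noncomputable def branchCode (x : α) : ℕ → Bool := fun k => f x (branchIndex hb x k)

/-- The coordinates skipped by the code are constant on the current cylinder, so equal codes force
equality of all coordinates. -/
theorem branchCode_injective (hf : Function.Injective f) :
    Function.Injective (branchCode hb) := by
  intro x y hxy
  have key : ∀ k, y ∈ cyl f (branchIndex hb x k) x := by
    intro k
    induction k with
    | zero => exact mem_cyl_nextBranch hb (fun i hi => absurd hi (Nat.not_lt_zero i))
    | succ k ih =>
      refine mem_cyl_nextBranch hb (mem_cyl_succ ih ?_)
      have := congrFun hxy k
      unfold branchCode at this
      rw [branchIndex_congr hb ih] at this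
      exact this.symm
  exact hf (funext fun i => (key (i + 1) i
    (lt_of_lt_of_le i.lt_succ_self ((branchIndex_strictMono hb x).id_le (i + 1)))).symm)

/-- At a branching coordinate either value can be taken without changing earlier coordinates, hence
without changing earlier code entries. This gives density of the image. -/
theorem exists_branchCode_eq [Nonempty α] (b : ℕ → Bool) (K : ℕ) :
    ∃ x : α, ∀ k < K, branchCode hb x k = b k := by
  induction K with
  | zero => exact ⟨Classical.arbitrary α, fun k hk => absurd hk (Nat.not_lt_zero k)⟩
  | succ K ih =>
    obtain ⟨x, hx⟩ := ih
    obtain ⟨y, hy, hyb⟩ := branches_branchIndex hb x K (b K)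
    refine ⟨y, fun k hk => ?_⟩
    have hle : branchIndex hb x k ≤ branchIndex hb x K :=
      (branchIndex_strictMono hb x).monotone (Nat.lt_succ_iff.1 hk)
    rw [branchCode, branchIndex_congr hb (cyl_anti hle x hy)]
    rcases Nat.lt_succ_iff_lt_or_eq.1 hk with hk | rfl
    · rw [hy _ (branchIndex_strictMono hb x hk), ← hx k hk, branchCode]
    · exact hyb

variable [TopologicalSpace α]

theorem isOpen_cyl (hf : Continuous f) (n : ℕ) (x : α) : IsOpen (cyl f n x) := by
  have : cyl f n x = ⋂ i ∈ Finset.range n, (fun y => f y i) ⁻¹' {f x i} := by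
    ext y; simp [cyl]
  rw [this]
  exact isOpen_biInter_finset fun i _ =>
    (isOpen_discrete _).preimage ((continuous_apply i).comp hf)

theorem continuous_branchCode (hf : Continuous f) : Continuous (branchCode hb) := by
  rw [continuous_pi_iff]
  intro k
  refine (IsLocallyConstant.iff_exists_open _).2 (fun x => ?_) |>.continuous
  refine ⟨_, isOpen_cyl hf (branchIndex hb x k + 1) x, mem_cyl_self _ x, fun y hy => ?_⟩
  rw [branchCode, branchIndex_congr hb (cyl_anti (Nat.le_succ _) x hy)]
  exact hy _ (Nat.lt_succ_self _)

/-- A nonempty compact space without isolated points that embeds into a Cantor cube is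
homeomorphic to the Cantor space. -/
theorem nonempty_homeomorph_nat_bool [CompactSpace α] [Nonempty α] (hf : Continuous f)
    (hinj : Function.Injective f) (hiso : ∀ x : α, ¬ IsOpen ({x} : Set α)) :
    Nonempty (α ≃ₜ (ℕ → Bool)) := by
  -- If nothing branched from `n` on, the open cylinder of depth `n` would be `{x}`, an isolated
  -- point.
  have hb : ∀ x n, ∃ m, n ≤ m ∧ Branches f x m := by
    intro x n
    by_contra! h
    refine hiso x ?_
    have : {x} = cyl f n x := by
      refine Subset.antisymm (singleton_subset_iff.2 (mem_cyl_self n x)) fun y hy => ?_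
      have key : ∀ m, n ≤ m → y ∈ cyl f m x := by
        intro m hm
        induction m, hm using Nat.le_induction with
        | base => exact hy
        | succ m hm ih => exact mem_cyl_succ ih (eq_of_not_branches (h m hm) ih)
      exact hinj (funext fun i => key (n + i + 1) (by omega) i (by omega))
    rw [this]
    exact isOpen_cyl hf n x
  have hc := continuous_branchCode hb hf
  -- The image is compact, hence closed, and it is dense.
  have hs : Function.Surjective (branchCode hb) := by
    rw [← range_eq_univ, ← (isCompact_range hc).isClosed.closure_eq, eq_univ_iff_forall]
    intro b
    rw [mem_closure_iff_nhds]
    intro U hU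
    rw [nhds_pi, Filter.mem_pi] at hU
    obtain ⟨I, hI, t, ht, hIt⟩ := hU
    obtain ⟨K, hK⟩ := hI.bddAbove
    obtain ⟨x, hx⟩ := exists_branchCode_eq hb b (K + 1)
    refine ⟨_, hIt fun k hk => ?_, mem_range_self x⟩
    rw [hx k (Nat.lt_succ_of_le (hK hk))]
    exact mem_of_mem_nhds (ht k)
  exact ⟨Continuous.homeoOfEquivCompactToT2
    (f := Equiv.ofBijective _ ⟨branchCode_injective hb hinj, hs⟩) hc⟩

end Brouwer

/-! ### Perfect compact sets of marked groups -/

namespace MarkedGroup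

variable {k : ℕ}

open Classical in
/-- A nonempty compact set of marked groups without isolated points is a Cantor set. -/
theorem nonempty_homeomorph_cantorSet {V : Set (MarkedGroup k)} (hV : IsCompact V)
    (hne : V.Nonempty) (hp : V ⊆ derivedSet V) : Nonempty (V ≃ₜ cantorSet) := by
  have : CompactSpace V := isCompact_iff_compactSpace.1 hV
  have : Nonempty V := hne.to_subtype
  obtain ⟨e⟩ : Nonempty (FreeGroup (Fin k) ↪ ℕ) :=
    let ⟨f, hf⟩ := exists_injective_nat (FreeGroup (Fin k)); ⟨⟨f, hf⟩⟩
  -- Kernel indicators reindexed by `ℕ` along `e`. Indices outside the range of `e` get the constant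
  -- `false`, so they never branch.
  let F : V → ℕ → Bool := fun M n =>
    if h : ∃ g, e g = n then (M : MarkedGroup k).kerIndicator h.choose else false
  have hF : ∀ (M : V) g, F M (e g) = (M : MarkedGroup k).kerIndicator g := by
    intro M g
    have h : ∃ g', e g' = e g := ⟨g, rfl⟩
    simp only [F]
    rw [dif_pos h, e.injective h.choose_spec]
  have hcont : Continuous F := by
    rw [continuous_pi_iff]
    intro n
    by_cases h : ∃ g, e g = n
    · obtain ⟨g, rfl⟩ := h
      simp only [hF]
      exact (continuous_apply g).comp
        (isInducing_kerIndicator.continuous.comp continuous_subtype_val)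
    · simp only [F, dif_neg h]
      exact continuous_const
  have hinj : Function.Injective F := fun M M' h =>
    Subtype.ext (kerIndicator_injective (funext fun g => by rw [← hF, ← hF, h]))
  obtain ⟨h⟩ := nonempty_homeomorph_nat_bool hcont hinj (by
    rintro ⟨M, hM⟩ ho
    obtain ⟨U, hU, hUM⟩ := isOpen_induced_iff.1 ho
    have hMU : M ∈ U := by
      have : (⟨M, hM⟩ : V) ∈ Subtype.val ⁻¹' U := by rw [hUM]; rfl
      exact this
    obtain ⟨M', ⟨h1, h2⟩, h3⟩ := accPt_iff_nhds.1 (hp hM) U (hU.mem_nhds hMU)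
    have : (⟨M', h2⟩ : V) ∈ ({⟨M, hM⟩} : Set V) := by rw [← hUM]; exact h1
    exact h3 (congrArg Subtype.val this))
  exact ⟨h.trans cantorSetHomeomorphNatToBool.symm⟩

end MarkedGroup

/-! ## The groups of an oracle and a set of symbols -/

/-- The empty word and the letters other than `a` that act trivially at all symbols of `T`. -/
def silentWords (T : Set (Fin 3)) : Set Word :=
  {w | w = [] ∨ ∃ y : Fin 8, y ≠ 0 ∧ w = [y] ∧ ∀ s ∈ T, acts s y = false}

/-- The words that decompose into letters silent on `T`, at all large depths. -/
def Triv (T : Set (Fin 3)) (ω : Oracle) (w : Word) : Prop :=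
  ∀ᶠ n in Filter.atTop, Nuc (silentWords T) n ω w

/-- A family of predicates on words that is compatible with decomposition. -/
structure SelfSimilar (Q : Oracle → Word → Prop) : Prop where
  congr : ∀ ω u v, Eqv u v → (Q ω u ↔ Q ω v)
  step : ∀ ω w, Q ω w ↔ odd w = false ∧ Q (shift ω) (sec (ω 0) false w) ∧
    Q (shift ω) (sec (ω 0) true w)

/-- Asking for all large depths makes the condition invariant under a shift of depth by one, so the
depth disappears from the recursion. -/
theorem selfSimilar_triv (T : Set (Fin 3)) : SelfSimilar (Triv T) where
  congr ω u v h := Filter.eventually_congr (Filter.Eventually.of_forall fun n => Nuc.congr h)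
  step ω w := by
    unfold Triv
    rw [← Filter.map_add_atTop_eq_nat 1, Filter.eventually_map]
    simp only [nuc_succ, Filter.eventually_and, Filter.map_add_atTop_eq_nat,
      Filter.eventually_const]

theorem Triv.congr {T : Set (Fin 3)} {ω : Oracle} {u v : Word} (h : Eqv u v) :
    Triv T ω u ↔ Triv T ω v := (selfSimilar_triv T).congr ω u v h

theorem triv_step {T : Set (Fin 3)} {ω : Oracle} {w : Word} :
    Triv T ω w ↔ odd w = false ∧ Triv T (shift ω) (sec (ω 0) false w) ∧
      Triv T (shift ω) (sec (ω 0) true w) := (selfSimilar_triv T).step ω w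

theorem triv_nil (T : Set (Fin 3)) (ω : Oracle) : Triv T ω [] :=
  Filter.Eventually.of_forall fun n => Nuc.nil (Or.inl rfl) n

theorem triv_of_eqv_nil {T : Set (Fin 3)} {ω : Oracle} {w : Word} (h : Eqv w []) :
    Triv T ω w := (Triv.congr h).2 (triv_nil T ω)

theorem nuc_silentWords_singleton {T : Set (Fin 3)} {y : Fin 8} (hy : y ≠ 0) (n : ℕ)
    (ω : Oracle) : Nuc (silentWords T) n ω [y] ↔
      (∀ i < n, acts (ω i) y = false) ∧ ∀ s ∈ T, acts s y = false := by
  induction n generalizing ω with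
  | zero =>
    change [y] ∈ silentWords T ↔ _
    simp [silentWords, hy]
  | succ n ih =>
    have h0 : Nuc (silentWords T) n (shift ω) (sec (ω 0) false [y]) ↔ acts (ω 0) y = false := by
      by_cases h : acts (ω 0) y = true
      · simp only [sec, if_neg hy, h, if_true, List.append_nil, Bool.false_eq_true, if_false,
          Bool.true_eq_false, iff_false]
        cases n with
        | zero =>
          change [0] ∉ silentWords T
          simp [silentWords]
        | succ n => rw [nuc_succ]; rintro ⟨h, -⟩; revert h; decide
      · simp only [sec, if_neg hy, h, if_false, List.append_nil, Bool.false_eq_true]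
        simp only [Nuc.nil (E := silentWords T) (Or.inl rfl) n]
    have h1 : sec (ω 0) true [y] = [y] := by simp [sec, hy]
    rw [nuc_succ, h0, h1, ih, show odd [y] = false by simp [odd, hy], Nat.forall_lt_succ_left]
    simp only [shift, true_and, and_assoc]

/-- A letter decomposes as `(P or I, y)`, and a `P` is the nontrivial word `a`; so `y` must be
silent all along the oracle and then on `T`. -/
theorem triv_singleton {T : Set (Fin 3)} {ω : Oracle} {y : Fin 8} (hy : y ≠ 0) :
    Triv T ω [y] ↔ (∀ i, acts (ω i) y = false) ∧ ∀ s ∈ T, acts s y = false := by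
  unfold Triv
  simp only [nuc_silentWords_singleton hy, Filter.eventually_and, Filter.eventually_const]
  refine and_congr_left' ⟨fun h i => ?_, fun h => Filter.Eventually.of_forall fun n i _ => h i⟩
  obtain ⟨n, hn, hi⟩ := (h.and (Filter.eventually_gt_atTop i)).exists
  exact hn i hi

theorem not_triv_of_odd {T : Set (Fin 3)} {ω : Oracle} {w : Word} (h : odd w = true) :
    ¬ Triv T ω w := by
  rw [triv_step, h]; simp

theorem shift_iterate (m : ℕ) (ω : Oracle) (i : ℕ) : (shift^[m] ω) i = ω (m + i) := by
  induction m generalizing ω with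
  | zero => simp
  | succ m ih => rw [Function.iterate_succ_apply, ih, shift]; congr 1; omega

/-- Self-similar predicates that agree on letters at depth `m` agree on words of length at most
`2 ^ m`. -/
theorem SelfSimilar.agree {Q Q' : Oracle → Word → Prop} (hQ : SelfSimilar Q)
    (hQ' : SelfSimilar Q') {m : ℕ} {ω ω' : Oracle} {w : Word} (hω : ∀ i < m, ω i = ω' i)
    (hl : ∀ y : Fin 8, y ≠ 0 → (Q (shift^[m] ω) [y] ↔ Q' (shift^[m] ω') [y]))
    (hnil : ∀ ω, Q ω [] ↔ Q' ω [])
    (hnil' : ∀ ω ω', Q ω [] ↔ Q ω' [])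
    (hw : (reduce w).length ≤ 2 ^ m) : Q ω w ↔ Q' ω' w := by
  induction m generalizing ω ω' w with
  | zero =>
    rw [hQ.congr _ _ _ (eqv_reduce w), hQ'.congr _ _ _ (eqv_reduce w)]
    generalize reduce w = v at hw
    rcases v with _ | ⟨y, _ | ⟨z, v⟩⟩
    · rw [hnil' ω ω', hnil]
    · by_cases hy : y = 0
      · subst hy
        rw [hQ.step, hQ'.step]
        simp [odd]
      · exact hl y hy
    · simp at hw
  | succ m ih =>
    rw [hQ.step, hQ'.step, ← hω 0 (Nat.succ_pos m)]
    -- Twice the length of a section is at most `2 ^ (m + 1) + 1`, and parity absorbs the `1`.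
    have hlen : ∀ i, (reduce (sec (ω 0) i w)).length ≤ 2 ^ m := by
      intro i
      rw [sec_eqv (ω 0) i (eqv_reduce w)]
      have h1 := length_reduce_le (sec (ω 0) i (reduce w))
      have h2 := length_sec_le (ω 0) (isReduced_reduce w) i
      rw [pow_succ] at hw
      omega
    have h : ∀ i, Q (shift ω) (sec (ω 0) i w) ↔ Q' (shift ω') (sec (ω 0) i w) := fun i =>
      ih (fun i hi => hω (i + 1) (Nat.succ_lt_succ hi)) hl (hlen i)
    rw [h, h]

/-! ### Dependence of triviality on a prefix and on the tail symbols -/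

/-- The symbols occurring from position `N` on. -/
def tailSymbols (ω : Oracle) (N : ℕ) : Set (Fin 3) := {s | ∃ i, N ≤ i ∧ ω i = s}

/-- The symbols occurring infinitely often. -/
def limSymbols (ω : Oracle) : Set (Fin 3) := {s | ∃ᶠ i in Filter.atTop, ω i = s}

/-- At depth `m` only words of at most one letter remain. For these, the symbols still to come and
the symbols of `T` matter only through their union. -/
theorem triv_agree {T T' : Set (Fin 3)} {ω ω' : Oracle} {m : ℕ} {w : Word}
    (hω : ∀ i < m, ω i = ω' i) (hT : T ∪ tailSymbols ω m = T' ∪ tailSymbols ω' m)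
    (hw : (reduce w).length ≤ 2 ^ m) : Triv T ω w ↔ Triv T' ω' w := by
  refine (selfSimilar_triv T).agree (selfSimilar_triv T') hω (fun y hy => ?_)
    (fun ω => iff_of_true (triv_nil _ _) (triv_nil _ _))
    (fun _ _ => iff_of_true (triv_nil _ _) (triv_nil _ _)) hw
  have key : ∀ (T : Set (Fin 3)) (ω : Oracle), Triv T (shift^[m] ω) [y] ↔
      ∀ s ∈ T ∪ tailSymbols ω m, acts s y = false := by
    intro T ω
    rw [triv_singleton hy]
    simp only [shift_iterate]
    constructor
    · rintro ⟨h1, h2⟩ s (hs | ⟨i, hi, rfl⟩)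
      · exact h2 s hs
      · have := h1 (i - m)
        rwa [Nat.add_sub_cancel' hi] at this
    · intro h
      exact ⟨fun i => h _ (Or.inr ⟨m + i, Nat.le_add_right _ _, rfl⟩), fun s hs => h s (Or.inl hs)⟩
  rw [key, key, hT]

/-- The symbols of `ω` are eventually in the nonempty set `T`. -/
def Admissible (T : Set (Fin 3)) (ω : Oracle) : Prop :=
  T.Nonempty ∧ ∀ᶠ i in Filter.atTop, ω i ∈ T

theorem Admissible.exists_forall {T : Set (Fin 3)} {ω : Oracle} (h : Admissible T ω) :
    ∃ N, ∀ i, N ≤ i → ω i ∈ T := Filter.eventually_atTop.1 h.2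

theorem eventually_mem_limSymbols (ω : Oracle) :
    ∀ᶠ i in Filter.atTop, ω i ∈ limSymbols ω := by
  have : ∀ s : Fin 3, ∀ᶠ i in Filter.atTop, ω i = s → s ∈ limSymbols ω := by
    intro s
    by_cases h : s ∈ limSymbols ω
    · exact Filter.Eventually.of_forall fun _ _ => h
    · exact (Filter.not_frequently.1 h).mono fun i hi h => absurd h hi
  filter_upwards [Filter.eventually_all.2 this] with i hi using hi _ rfl

theorem admissible_limSymbols (ω : Oracle) : Admissible (limSymbols ω) ω :=
  ⟨let ⟨_, hi⟩ := (eventually_mem_limSymbols ω).exists; ⟨_, hi⟩, eventually_mem_limSymbols ω⟩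

theorem limSymbols_subset_iff {T : Set (Fin 3)} {ω : Oracle} :
    limSymbols ω ⊆ T ↔ ∀ᶠ i in Filter.atTop, ω i ∈ T := by
  constructor
  · intro h; exact (eventually_mem_limSymbols ω).mono fun i hi => h hi
  · intro h s hs
    obtain ⟨i, rfl, hi⟩ := (Filter.Frequently.and_eventually hs h).exists
    exact hi

theorem limSymbols_shift (ω : Oracle) : limSymbols (shift ω) = limSymbols ω := by
  ext s
  unfold limSymbols
  rw [Set.mem_ofPred_eq, Set.mem_ofPred_eq]
  conv_rhs => rw [← Filter.map_add_atTop_eq_nat 1, Filter.frequently_map]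
  rfl

theorem limSymbols_shift_iterate (n : ℕ) (ω : Oracle) :
    limSymbols (shift^[n] ω) = limSymbols ω := by
  induction n generalizing ω with
  | zero => rfl
  | succ n ih => rw [Function.iterate_succ_apply, ih, limSymbols_shift]

/-! ### The modified overgroups as groups of pairs -/

/-- The marked group in which exactly the words in `Triv T ω` are trivial. -/
def IsGroupOf (T : Set (Fin 3)) (ω : Oracle) (M : MarkedGroup 8) : Prop :=
  ∀ g, g ∈ M.ker ↔ Triv T ω (spell g)

theorem IsGroupOf.eq {T : Set (Fin 3)} {ω : Oracle} {M M' : MarkedGroup 8}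
    (h : IsGroupOf T ω M) (h' : IsGroupOf T ω M') : M = M' :=
  MarkedGroup.ext (Subgroup.ext fun g => (h g).trans (h' g).symm)

theorem IsGroupOf.mem_iff {T : Set (Fin 3)} {ω : Oracle} {M : MarkedGroup 8}
    (h : IsGroupOf T ω M) (w : Word) :
    FreeGroup.mk (w.map fun y => (y, true)) ∈ M.ker ↔ Triv T ω w := by
  rw [h, Triv.congr (eqv_spell _), List.map_map]
  simp [Function.comp_def]

/-- By `nucleusIn_iff` the depth chosen by an algorithm is immaterial: acceptance at one depth from
`N₀` on persists at all larger depths. -/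
theorem isGroupOf_of_nucleusSubgroup {E : Set Word} {N₀ : ℕ} {ω : Oracle} (hE : Adm E N₀ ω)
    {T : Set (Fin 3)} (hT : silentWords T = E) {M : MarkedGroup 8}
    (hM : ∀ g, g ∈ M.ker ↔ g ∈ nucleusSubgroup E N₀ ω hE) : IsGroupOf T ω M := by
  subst hT
  intro g
  rw [hM]
  refine (nucleusIn_iff hE _).trans ⟨?_, ?_⟩
  · rintro ⟨n, hn, h⟩
    exact Filter.eventually_atTop.2 ⟨n, fun m hm => Nuc.mono (hE.mono hn) hm h⟩
  · intro h
    obtain ⟨n, h1, h2⟩ := (h.and (Filter.eventually_ge_atTop N₀)).exists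
    exact ⟨n, h2, h1⟩

theorem silentWords_univ : silentWords univ = {[]} := by
  ext w
  simp only [silentWords, mem_ofPred_eq, mem_singleton_iff, mem_univ, forall_const,
    or_iff_left_iff_imp]
  rintro ⟨y, hy, -, h⟩
  exfalso
  revert y
  decide

/-- The letter `x` is never silent, `b, c, d` are silent at one symbol each, and `b~, c~, d~` at two
each; so exactly one letter is silent at both symbols other than `k`. -/
theorem silentWords_compl (k : Fin 3) : silentWords {k}ᶜ = {[], [eLetter k]} := by
  ext w
  simp only [silentWords, mem_ofPred_eq, mem_insert_iff, mem_singleton_iff, mem_compl_iff]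
  refine or_congr_right ⟨?_, ?_⟩
  · rintro ⟨y, hy, rfl, h⟩
    congr 1
    revert y k
    decide
  · rintro rfl
    refine ⟨eLetter k, ?_, rfl, ?_⟩
    all_goals revert k; decide

theorem isGroupOf_alphaOvergroup (ω : Oracle) : IsGroupOf univ ω (alphaOvergroup ω) := by
  refine isGroupOf_of_nucleusSubgroup (adm_alpha ω) silentWords_univ fun g => ?_
  change NucleusIn _ _ _ _ ↔ NucleusIn _ _ _ _
  rw [Nat.zero_max]

theorem isGroupOf_betaOvergroup (k : Fin 3) (ω : Oracle) (h : {n | ω n = k}.Finite) :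
    IsGroupOf {k}ᶜ ω (betaOvergroup k ω h) :=
  isGroupOf_of_nucleusSubgroup (adm_beta h) (silentWords_compl k) fun _ => Iff.rfl

/-! ### The action on the tree -/

theorem letterPerm_true (ω : Oracle) (y : Fin 8) (v : List Bool) :
    letterPerm ω y (true :: v) = true :: letterPerm (shift ω) y v := rfl

theorem letterPerm_false (ω : Oracle) (y : Fin 8) (v : List Bool) :
    letterPerm ω y (false :: v) = false :: (if acts (ω 0) y then flip v else v) := rfl

theorem acts_xor : ∀ (s : Fin 3) (y z : Fin 8), y ≠ 0 → z ≠ 0 → y ≠ z →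
    acts s (y ^^^ z) = (acts s y ^^ acts s z) := by decide

theorem letterPerm_letterPerm {y z : Fin 8} (hy : y ≠ 0) (hz : z ≠ 0) (h : y ≠ z) (ω : Oracle)
    (v : List Bool) : letterPerm ω y (letterPerm ω z v) = letterPerm ω (y ^^^ z) v := by
  induction v generalizing ω with
  | nil => rfl
  | cons i v ih =>
    cases i
    · simp only [letterPerm_false, acts_xor _ y z hy hz h]
      cases acts (ω 0) y <;> cases acts (ω 0) z <;> simp [flip_involutive v]
    · simp only [letterPerm_true, ih]

theorem overgroupGens_zero (ω : Oracle) (v : List Bool) : overgroupGens ω 0 v = flip v := rfl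

theorem overgroupGens_of_ne {y : Fin 8} (hy : y ≠ 0) (ω : Oracle) (v : List Bool) :
    overgroupGens ω y v = letterPerm ω y v := by
  fin_cases y
  · exact absurd rfl hy
  all_goals first
    | rfl
    | exact letterPerm_letterPerm (by decide) (by decide) (by decide) ω v

theorem letterPerm_self (ω : Oracle) (y : Fin 8) (v : List Bool) :
    letterPerm ω y (letterPerm ω y v) = v := directed_involutive _ v

theorem overgroupGens_self (ω : Oracle) (y : Fin 8) (v : List Bool) :
    overgroupGens ω y (overgroupGens ω y v) = v := by
  by_cases hy : y = 0
  · subst hy; exact flip_involutive v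
  · rw [overgroupGens_of_ne hy, overgroupGens_of_ne hy, letterPerm_self]

/-- The action of a word on the vertices of the tree, letter by letter from the left. -/
def run (ω : Oracle) (w : Word) (v : List Bool) : List Bool :=
  w.foldl (fun v y => overgroupGens ω y v) v

theorem run_cons (ω : Oracle) (y : Fin 8) (w : Word) (v : List Bool) :
    run ω (y :: w) v = run ω w (overgroupGens ω y v) := rfl

theorem run_nil_right (ω : Oracle) (w : Word) : run ω w [] = [] := by
  induction w with
  | nil => rfl
  | cons y w ih =>
    rw [run_cons]
    by_cases hy : y = 0
    · subst hy; exact ih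
    · rw [overgroupGens_of_ne hy]; exact ih

theorem run_congr (ω : Oracle) {u v : Word} (h : Eqv u v) : run ω u = run ω v := by
  have key : ∀ w, run ω w = run ω (reduce w) := by
    refine rel_reduce (fun u v => run ω u = run ω v) (fun _ => rfl)
      (fun _ _ _ h h' => h.trans h') ?_ ?_ ?_
    · intro y u v h
      funext t
      rw [run_cons, run_cons, h]
    · intro y w
      funext t
      rw [run_cons, run_cons, overgroupGens_self]
    · intro y z w hy hz h
      funext t
      rw [run_cons, run_cons, run_cons, overgroupGens_of_ne hy, overgroupGens_of_ne hz,
        overgroupGens_of_ne (xor_ne y z h), letterPerm_letterPerm hz hy h.symm]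
      congr 2
      have : z ^^^ y = y ^^^ z := by clear hy hz h; revert y z; decide
      rw [this]
  rw [key, key v]
  exact congrArg _ h

/-- The formal decomposition `sec` computes the sections of the tree action, which makes trivial
action a self-similar predicate. -/
theorem run_bool_cons (ω : Oracle) (w : Word) (i : Bool) (v : List Bool) :
    run ω w (i :: v) = (i ^^ odd w) :: run (shift ω) (sec (ω 0) i w) v := by
  induction w generalizing i v with
  | nil => simp [run, odd, sec]
  | cons y w ih =>
    rw [run_cons, odd_cons, sec]
    by_cases hy : y = 0
    · subst hy
      rw [overgroupGens_zero, flip, ih]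
      cases i <;> simp
    · rw [overgroupGens_of_ne hy, if_neg hy, if_neg hy]
      cases i
      · rw [letterPerm_false, ih]
        by_cases h : acts (ω 0) y <;> simp [h, run_cons, overgroupGens_zero]
      · rw [letterPerm_true, ih]
        simp [run_cons, overgroupGens_of_ne hy]

theorem selfSimilar_run : SelfSimilar fun ω w => ∀ v, run ω w v = v where
  congr ω u v h := by simp only [run_congr ω h]
  step ω w := by
    constructor
    · intro h
      have h1 := h [true]
      rw [run_bool_cons] at h1
      have ho : odd w = false := by simpa using (List.cons.inj h1).1
      refine ⟨ho, fun v => ?_, fun v => ?_⟩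
      · have := h (false :: v)
        rw [run_bool_cons] at this
        exact (List.cons.inj this).2
      · have := h (true :: v)
        rw [run_bool_cons] at this
        exact (List.cons.inj this).2
    · rintro ⟨ho, hf, ht⟩ v
      rcases v with _ | ⟨i, v⟩
      · exact run_nil_right ω w
      · rw [run_bool_cons, ho, Bool.xor_false]
        cases i
        · rw [hf]
        · rw [ht]

theorem run_singleton {y : Fin 8} (hy : y ≠ 0) (ω : Oracle) :
    (∀ v, run ω [y] v = v) ↔ ∀ i, acts (ω i) y = false := by
  have key : ∀ ω : Oracle, (∀ v, run ω [y] v = v) ↔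
      acts (ω 0) y = false ∧ ∀ v, run (shift ω) [y] v = v := by
    intro ω
    rw [selfSimilar_run.step]
    have h1 : sec (ω 0) true [y] = [y] := by simp [sec, hy]
    rw [h1, show odd [y] = false by simp [odd, hy]]
    by_cases h : acts (ω 0) y = true
    · have h2 : sec (ω 0) false [y] = [0] := by simp [sec, hy, h]
      rw [h2, h]
      simp only [true_and, Bool.true_eq_false, false_and, iff_false, not_and]
      intro h3
      exact absurd (h3 [true]) (by simp [run, overgroupGens_zero, flip])
    · have h2 : sec (ω 0) false [y] = [] := by simp [sec, hy, h]
      rw [h2]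
      simp [run, h]
  constructor
  · intro h i
    induction i generalizing ω with
    | zero => exact ((key ω).1 h).1
    | succ i ih => exact ih (shift ω) ((key ω).1 h).2
  · intro h v
    induction v generalizing ω with
    | nil => exact run_nil_right ω _
    | cons i v ih =>
      rw [run_bool_cons]
      cases i
      · simp [sec, hy, h 0, odd, run]
      · have := ih (shift ω) fun i => h (i + 1)
        simp [sec, hy, odd, this]

theorem lift_overgroupGens (ω : Oracle) (g : FreeGroup (Fin 8)) :
    FreeGroup.lift (overgroupGens ω) g = ((spell g).map (overgroupGens ω)).prod := by
  conv_lhs => rw [← FreeGroup.mk_toWord (x := g)]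
  rw [FreeGroup.lift_mk, spell, List.map_map]
  congr 1
  refine List.map_congr_left fun p _ => ?_
  have hinv : (overgroupGens ω p.1)⁻¹ = overgroupGens ω p.1 :=
    inv_eq_of_mul_eq_one_left (Equiv.ext fun v => overgroupGens_self ω p.1 v)
  rw [hinv]
  simp

/-- `run` applies the leftmost letter first, while a product of permutations applies the rightmost
first. Since the letters are involutions, the two differ by inversion, which does not affect
triviality. -/
theorem prod_inv_apply (ω : Oracle) (w : Word) (v : List Bool) :
    ((w.map (overgroupGens ω)).prod)⁻¹ v = run ω w v := by
  induction w generalizing v with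
  | nil => rfl
  | cons y w ih =>
    rw [List.map_cons, List.prod_cons, mul_inv_rev, Equiv.Perm.mul_apply, ih, run_cons]
    congr 1
    rw [Equiv.Perm.inv_eq_iff_eq, overgroupGens_self]

theorem mem_ker_overgroup (ω : Oracle) (g : FreeGroup (Fin 8)) :
    g ∈ (overgroup ω).ker ↔ ∀ v, run ω (spell g) v = v := by
  change FreeGroup.lift (overgroupGens ω) g = 1 ↔ _
  rw [lift_overgroupGens, ← inv_eq_one, Equiv.ext_iff]
  simp only [prod_inv_apply, Equiv.Perm.one_apply]

/-- A letter silent on a tail of `ω` is automatically silent at the symbols that recur, so the extra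
condition from `limSymbols ω` is vacuous. Both predicates thus agree on letters, and
`SelfSimilar.agree` extends this to words. -/
theorem isGroupOf_overgroup (ω : Oracle) : IsGroupOf (limSymbols ω) ω (overgroup ω) := by
  intro g
  rw [mem_ker_overgroup]
  obtain ⟨N, hN⟩ := (admissible_limSymbols ω).exists_forall
  obtain ⟨m, hm⟩ := ((Filter.eventually_ge_atTop N).and
    (Filter.eventually_ge_atTop (reduce (spell g)).length)).exists
  refine selfSimilar_run.agree (selfSimilar_triv (limSymbols ω)) (m := m) (fun _ _ => rfl)
    (fun y hy => ?_) (fun ω => iff_of_true (fun _ => rfl) (triv_nil _ _))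
    (fun _ _ => iff_of_true (fun _ => rfl) (fun _ => rfl)) (hm.2.trans Nat.lt_two_pow_self.le)
  rw [run_singleton hy, triv_singleton hy]
  refine ⟨fun h => ⟨h, fun s hs => ?_⟩, fun h => h.1⟩
  obtain ⟨i, hi, rfl⟩ := Filter.frequently_atTop.1 hs m
  have := h (i - m)
  rwa [shift_iterate, Nat.add_sub_cancel' hi] at this

/-! ## Test words -/

theorem Eqv.trans {u v w : Word} (h : Eqv u v) (h' : Eqv v w) : Eqv u w := Eq.trans h h'

theorem Eqv.symm {u v : Word} (h : Eqv u v) : Eqv v u := Eq.symm h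

theorem eqv_reverse_append (u v : Word) : Eqv (u ++ (u.reverse ++ v)) v := by
  induction u generalizing v with
  | nil => rfl
  | cons y u ih =>
    have := Eqv.append_left [y] (ih (y :: v))
    simp only [List.reverse_cons, List.append_assoc, List.cons_append, List.nil_append] at this ⊢
    exact this.trans (eqv_cancel y v)

/-- The letters `d, c, b` that are silent exactly at the symbols `0, 1, 2`. -/
def silentLetter (k : Fin 3) : Fin 8 := ![3, 2, 1] k

/-- The substitution `a ↦ a x a`, that lifts words to the second coordinate. -/
def liftWord (w : Word) : Word := w.flatMap fun y => if y = 0 then [0, 4, 0] else [y]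

/-- The first coordinates of lifted words. -/
def coWord (s : Fin 3) (w : Word) : Word :=
  w.flatMap fun y => if y = 0 then [4] else if acts s y then [0] else []

theorem liftWord_append (u v : Word) : liftWord (u ++ v) = liftWord u ++ liftWord v :=
  List.flatMap_append

theorem coWord_append (s : Fin 3) (u v : Word) : coWord s (u ++ v) = coWord s u ++ coWord s v :=
  List.flatMap_append

theorem liftWord_cons (y : Fin 8) (w : Word) :
    liftWord (y :: w) = (if y = 0 then [0, 4, 0] else [y]) ++ liftWord w := List.flatMap_cons

theorem coWord_cons (s : Fin 3) (y : Fin 8) (w : Word) :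
    coWord s (y :: w) = (if y = 0 then [4] else if acts s y then [0] else []) ++ coWord s w :=
  List.flatMap_cons

theorem odd_liftWord (w : Word) : odd (liftWord w) = false := by
  induction w with
  | nil => rfl
  | cons y w ih =>
    rw [liftWord_cons, odd_append, ih]
    by_cases hy : y = 0 <;> simp [hy, odd]

theorem acts_four (s : Fin 3) : acts s 4 = true := by revert s; decide

theorem sec_true_liftWord (s : Fin 3) (w : Word) : sec s true (liftWord w) = w := by
  induction w with
  | nil => rfl
  | cons y w ih =>
    rw [liftWord_cons]
    by_cases hy : y = 0
    · subst hy
      simp [sec, acts_four, ih]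
    · simp [sec, hy, ih]

theorem sec_false_liftWord (s : Fin 3) (w : Word) : sec s false (liftWord w) = coWord s w := by
  induction w with
  | nil => rfl
  | cons y w ih =>
    rw [liftWord_cons, coWord_cons]
    by_cases hy : y = 0
    · subst hy
      simp [sec, ih]
    · simp [sec, hy, ih]

theorem coWord_reverse (s : Fin 3) (w : Word) : coWord s w.reverse = (coWord s w).reverse := by
  induction w with
  | nil => rfl
  | cons y w ih =>
    rw [List.reverse_cons, coWord_append, ih, coWord_cons s y w, List.reverse_append]
    congr 1
    rw [coWord_cons]
    split_ifs <;> rfl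

theorem liftWord_reverse (w : Word) : liftWord w.reverse = (liftWord w).reverse := by
  induction w with
  | nil => rfl
  | cons y w ih =>
    rw [List.reverse_cons, liftWord_append, ih, liftWord_cons y w, List.reverse_append]
    congr 1
    rw [liftWord_cons]
    split_ifs <;> rfl

/-- The word that `liftWord` gives for `a` after `j` steps. -/
def liftedA (j : ℕ) : Word := liftWord^[j] [0]

theorem liftedA_succ (j : ℕ) : liftedA (j + 1) = liftWord (liftedA j) :=
  Function.iterate_succ_apply' _ _ _

theorem liftedA_reverse (j : ℕ) : (liftedA j).reverse = liftedA j := by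
  induction j with
  | zero => rfl
  | succ j ih => rw [liftedA_succ, ← liftWord_reverse, ih]

/-- The words `(y g (xy) g)⁴`. -/
def quartic (y : Fin 8) (g : Word) : Word :=
  let c := y :: (g ++ (4 ^^^ y) :: g)
  c ++ (c ++ (c ++ c))

theorem liftWord_quartic {y : Fin 8} (hy : y ≠ 0) (hy4 : y ≠ 4) (g : Word) :
    liftWord (quartic y g) = quartic y (liftWord g) := by
  have h : (4 : Fin 8) ^^^ y ≠ 0 := xor_ne 4 y hy4.symm
  simp [quartic, liftWord_append, liftWord_cons, hy, h]

theorem acts_four_xor {y : Fin 8} (hy : y ≠ 0) (hy4 : y ≠ 4) (s : Fin 3) :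
    acts s (4 ^^^ y) = !(acts s y) := by
  rw [acts_xor s 4 y (by decide) hy hy4.symm, acts_four, Bool.true_xor]

/-- At each symbol exactly one of `y` and `xy` acts. If `p` is the first coordinate of the
palindrome `g`, then `p² = 1`, and `y g (xy) g` has first coordinate `a p p` or `p a p`, an
involution. -/
theorem eqv_coWord_quartic {y : Fin 8} (hy : y ≠ 0) (hy4 : y ≠ 4) (s : Fin 3) {g : Word}
    (hg : g.reverse = g) : Eqv (coWord s (quartic y g)) [] := by
  have h : (4 : Fin 8) ^^^ y ≠ 0 := xor_ne 4 y hy4.symm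
  have hc : ∀ v, Eqv (coWord s g ++ (coWord s g ++ v)) v := by
    intro v
    have := eqv_reverse_append (coWord s g) v
    rwa [← coWord_reverse, hg] at this
  simp only [quartic, coWord_append, coWord_cons, if_neg hy, if_neg h, acts_four_xor hy hy4]
  have ha : ∀ v, Eqv (0 :: 0 :: v) v := fun v => eqv_cancel 0 v
  generalize coWord s g = p at hc
  have hc0 : Eqv (p ++ p) [] := by simpa using hc []
  cases acts s y
  · simp only [Bool.not_false, if_true, Bool.false_eq_true, if_false, List.nil_append]
    have h2 : ∀ v, Eqv (p ++ (0 :: (p ++ (p ++ (0 :: (p ++ v)))))) v := fun v =>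
      ((Eqv.append_left p ((Eqv.append_left [0] (hc (0 :: (p ++ v)))).trans
        (ha (p ++ v))))).trans (hc v)
    have := (h2 (p ++ (0 :: (p ++ (p ++ (0 :: (p ++ [])))))))
    have := this.trans (h2 [])
    simpa using this
  · simp only [Bool.not_true, if_true, Bool.false_eq_true, if_false, List.nil_append]
    have h2 : ∀ v, Eqv (0 :: (p ++ (p ++ (0 :: (p ++ (p ++ v)))))) v := fun v =>
      ((Eqv.append_left [0] (hc (0 :: (p ++ (p ++ v))))).trans
        (ha (p ++ (p ++ v)))).trans (hc v)
    have := (h2 (0 :: (p ++ (p ++ (0 :: (p ++ (p ++ [])))))))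
    have := this.trans (h2 [])
    simpa using this

/-- The first coordinate vanishes, so the test word moves one level down unchanged. Iteration lets
it inspect any position of the oracle. -/
theorem triv_quartic_liftWord {T : Set (Fin 3)} {ω : Oracle} {y : Fin 8} (hy : y ≠ 0)
    (hy4 : y ≠ 4) {g : Word} (hg : g.reverse = g) :
    Triv T ω (quartic y (liftWord g)) ↔ Triv T (shift ω) (quartic y g) := by
  rw [← liftWord_quartic hy hy4, triv_step, odd_liftWord, sec_true_liftWord, sec_false_liftWord]
  simp [triv_of_eqv_nil (eqv_coWord_quartic hy hy4 (ω 0) hg)]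

theorem triv_quartic_liftedA {T : Set (Fin 3)} {ω : Oracle} {y : Fin 8} (hy : y ≠ 0)
    (hy4 : y ≠ 4) (j : ℕ) :
    Triv T ω (quartic y (liftedA j)) ↔ Triv T (shift^[j] ω) (quartic y [0]) := by
  induction j generalizing ω with
  | zero => rfl
  | succ j ih =>
    rw [liftedA_succ, triv_quartic_liftWord hy hy4 (liftedA_reverse j), ih,
      Function.iterate_succ_apply]

/-- `(ya)²` is trivial iff `y` is trivial one level below and silent at the first symbol. -/
theorem triv_ya_sq {T : Set (Fin 3)} {ω : Oracle} {y : Fin 8} (hy : y ≠ 0) :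
    Triv T ω [y, 0, y, 0] ↔ acts (ω 0) y = false ∧ Triv T (shift ω) [y] := by
  rw [triv_step]
  by_cases h : acts (ω 0) y = true
  · simp only [h, sec, if_neg hy, if_true, Bool.not_true, Bool.not_false, Bool.false_eq_true,
      if_false, List.append_nil, Bool.true_eq_false, false_and, iff_false]
    rintro ⟨-, h1, -⟩
    exact not_triv_of_odd (by simp [odd, hy]) h1
  · simp [h, sec, hy, odd]

theorem triv_ay_sq {T : Set (Fin 3)} {ω : Oracle} {y : Fin 8} (hy : y ≠ 0) :
    Triv T ω [0, y, 0, y] ↔ acts (ω 0) y = false ∧ Triv T (shift ω) [y] := by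
  rw [triv_step]
  by_cases h : acts (ω 0) y = true
  · simp only [h, sec, if_neg hy, if_true, Bool.not_true, Bool.not_false, Bool.false_eq_true,
      if_false, List.append_nil, Bool.true_eq_false, false_and, iff_false]
    rintro ⟨-, h1, -⟩
    exact not_triv_of_odd (by simp [odd, hy]) h1
  · simp [h, sec, hy, odd]

/-- Here `y` is silent and `xy` acts, so `(y a (xy) a)⁴` has coordinates `(xy)⁴ = 1` and `(ya)⁴`. -/
theorem triv_quartic_a {T : Set (Fin 3)} {ω : Oracle} {y : Fin 8} (hy : y ≠ 0)
    (hy4 : y ≠ 4) (h0 : acts (ω 0) y = false) :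
    Triv T ω (quartic y [0]) ↔ Triv T (shift ω) ([y, 0, y, 0] ++ [y, 0, y, 0]) := by
  have h : (4 : Fin 8) ^^^ y ≠ 0 := xor_ne 4 y hy4.symm
  have h1 : acts (ω 0) (4 ^^^ y) = true := by rw [acts_four_xor hy hy4, h0]; rfl
  have h2 : Triv T (shift ω) [4 ^^^ y, 4 ^^^ y, 4 ^^^ y, 4 ^^^ y] :=
    triv_of_eqv_nil ((eqv_cancel _ _).trans (eqv_cancel _ _))
  rw [triv_step]
  simp [quartic, sec, hy, h, h0, h1, h2, odd]

theorem triv_ya_fourth_of_silent {T : Set (Fin 3)} {ω : Oracle} {y : Fin 8} (hy : y ≠ 0)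
    (h : acts (ω 0) y = false) : Triv T ω ([y, 0, y, 0] ++ [y, 0, y, 0]) := by
  have h2 : Triv T (shift ω) [y, y, y, y] :=
    triv_of_eqv_nil ((eqv_cancel _ _).trans (eqv_cancel _ _))
  rw [triv_step]
  simp only [List.cons_append, List.nil_append, sec, if_neg hy, h, if_true, Bool.not_true,
    Bool.not_false, Bool.false_eq_true, if_false]
  refine ⟨by simp [odd, hy], ?_, ?_⟩
  all_goals exact triv_of_eqv_nil (eqv_cancel _ _)

/-- When `y` acts, a coordinate of `(ya)⁴` is `(ya)²`, and triviality of the latter would make `y`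
silent on `T`. -/
theorem not_triv_ya_fourth {T : Set (Fin 3)} {ω : Oracle} {y : Fin 8} (hy : y ≠ 0)
    (h : acts (ω 0) y = true) (hT : ∃ s ∈ T, acts s y = true) :
    ¬ Triv T ω ([y, 0, y, 0] ++ [y, 0, y, 0]) := by
  rw [triv_step]
  simp only [List.cons_append, List.nil_append, sec, if_neg hy, h, if_true, Bool.not_true,
    Bool.not_false, Bool.false_eq_true, if_false]
  rintro ⟨-, -, h2⟩
  rw [triv_ya_sq hy, triv_singleton hy] at h2
  obtain ⟨s, hs, hsy⟩ := hT
  exact absurd (h2.2.2 s hs) (by simp [hsy])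

theorem silentLetter_ne_zero (k : Fin 3) : silentLetter k ≠ 0 := by revert k; decide

theorem silentLetter_ne_four (k : Fin 3) : silentLetter k ≠ 4 := by revert k; decide

theorem acts_silentLetter (s k : Fin 3) : acts s (silentLetter k) = !(decide (s = k)) := by
  revert s k; decide

/-- The test word `quartic (silentLetter i) (liftedA j)` detects the symbol after an `i` in
position `j`. -/
theorem triv_quartic_silentLetter {T : Set (Fin 3)} (hT : T.Nontrivial) {ω : Oracle}
    {i : Fin 3} {j : ℕ} (hi : ω j = i) :
    Triv T ω (quartic (silentLetter i) (liftedA j)) ↔ ω (j + 1) = i := by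
  have hy := silentLetter_ne_zero i
  have hy4 := silentLetter_ne_four i
  have h1 : (shift (shift^[j] ω)) 0 = ω (j + 1) := by rw [shift, shift_iterate]
  rw [triv_quartic_liftedA hy hy4, triv_quartic_a hy hy4
    (by rw [shift_iterate, Nat.add_zero, hi, acts_silentLetter]; simp)]
  constructor
  · intro h
    by_contra hne
    refine not_triv_ya_fourth hy ?_ ?_ h
    · rw [h1, acts_silentLetter]; simp [hne]
    · obtain ⟨s, hs, hsi⟩ := hT.exists_ne i
      exact ⟨s, hs, by rw [acts_silentLetter]; simp [hsi]⟩
  · intro h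
    exact triv_ya_fourth_of_silent hy (by rw [h1, h, acts_silentLetter]; simp)

/-! ### Commutators of powers -/

/-- The words `(ax)^(2^m)` and their inverses. -/
def axPow : ℕ → Word
  | 0 => [0, 4]
  | m + 1 => axPow m ++ axPow m

theorem axPow_reverse_succ (m : ℕ) :
    (axPow (m + 1)).reverse = (axPow m).reverse ++ (axPow m).reverse := List.reverse_append

theorem odd_axPow_succ (m : ℕ) : odd (axPow (m + 1)) = false := by
  rw [axPow, odd_append, Bool.xor_self]

/-- Because `x` acts at every symbol, `(ax)² = ((ax)⁻¹, ax)` whatever the oracle. -/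
theorem sec_axPow_succ (s : Fin 3) (m : ℕ) :
    sec s true (axPow (m + 1)) = axPow m ∧ sec s false (axPow (m + 1)) = (axPow m).reverse := by
  induction m with
  | zero => constructor <;> simp [axPow, sec, acts_four]
  | succ m ih =>
    rw [axPow, sec_append, sec_append, odd_axPow_succ]
    rw [Bool.xor_false, Bool.xor_false, ih.1, ih.2, ← axPow_reverse_succ]
    exact ⟨rfl, rfl⟩

/-- The dihedral relation: conjugation by `a` inverts `ax`. -/
theorem eqv_conj_axPow (m : ℕ) : Eqv (0 :: (axPow m ++ [0])) (axPow m).reverse := by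
  induction m with
  | zero => unfold Eqv; decide
  | succ m ih =>
    have h1 : Eqv (0 :: (axPow (m + 1) ++ [0]))
        (0 :: (axPow m ++ [0]) ++ 0 :: (axPow m ++ [0])) := by
      have := (Eqv.append_left (0 :: axPow m) (eqv_cancel 0 (axPow m ++ [0])))
      simpa [axPow] using this.symm
    rw [axPow_reverse_succ]
    exact h1.trans (ih.append ih)

theorem eqv_conj_axPow_reverse (m : ℕ) : Eqv (0 :: ((axPow m).reverse ++ [0])) (axPow m) := by
  simpa using (eqv_conj_axPow m).reverse

/-- The commutator of `(ax)^(2^m)` and its conjugate by the letter `y`. -/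
def commWord (y : Fin 8) (m : ℕ) : Word :=
  axPow m ++ y :: (axPow m ++ y :: ((axPow m).reverse ++ y :: ((axPow m).reverse ++ [y])))

/-- The second coordinate is the same commutator with half the exponent. In the first coordinate `y`
becomes `a` or `1`, so the two commuting elements are both powers of `ax` and the commutator
vanishes. -/
theorem triv_commWord_succ {T : Set (Fin 3)} {ω : Oracle} {y : Fin 8} (hy : y ≠ 0) (m : ℕ) :
    Triv T ω (commWord y (m + 1)) ↔ Triv T (shift ω) (commWord y m) := by
  have ho : odd (axPow (m + 1)).reverse = false := by rw [odd_reverse, odd_axPow_succ]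
  have ho' := odd_axPow_succ m
  have hs := sec_axPow_succ (ω 0) m
  have hsr : sec (ω 0) true (axPow (m + 1)).reverse = (axPow m).reverse ∧
      sec (ω 0) false (axPow (m + 1)).reverse = axPow m := by
    constructor
    · rw [sec_reverse, ho', Bool.xor_false, hs.1]
    · rw [sec_reverse, ho', Bool.xor_false, hs.2, List.reverse_reverse]
  have h1 : sec (ω 0) true (commWord y (m + 1)) = commWord y m := by
    simp [commWord, sec_append, sec, hy, ho, ho', hs, hsr]
  have h2 : Eqv (sec (ω 0) false (commWord y (m + 1))) [] := by
    set u := axPow m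
    have huv : ∀ v, Eqv (u ++ (u.reverse ++ v)) v := eqv_reverse_append u
    have hvu : ∀ v, Eqv (u.reverse ++ (u ++ v)) v := fun v => by
      simpa using eqv_reverse_append u.reverse v
    by_cases h : acts (ω 0) y = true
    · have h3 : sec (ω 0) false (commWord y (m + 1)) =
          u.reverse ++ ((0 :: (u.reverse ++ [0])) ++ (u ++ (0 :: (u ++ [0])))) := by
        simp [commWord, sec_append, sec, hy, ho, ho', hs, hsr, h, u]
      rw [h3]
      have h4 : Eqv (u.reverse ++ ((0 :: (u.reverse ++ [0])) ++ (u ++ (0 :: (u ++ [0])))))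
          (u.reverse ++ (u ++ (u ++ u.reverse))) :=
        Eqv.append_left _ ((eqv_conj_axPow_reverse m).append
          (Eqv.append_left _ (eqv_conj_axPow m)))
      refine h4.trans ((hvu _).trans ?_)
      simpa using huv []
    · have h3 : sec (ω 0) false (commWord y (m + 1)) =
          u.reverse ++ (u.reverse ++ (u ++ u)) := by
        simp [commWord, sec_append, sec, hy, ho, ho', hs, hsr, h, u]
      rw [h3]
      refine (Eqv.append_left _ (hvu u)).trans ?_
      simpa using hvu []
  have h3 : odd (commWord y (m + 1)) = false := by
    simp only [commWord, odd_append, odd_cons, if_neg hy, ho, ho']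
    rfl
  rw [triv_step, h1, h3]
  simp only [triv_of_eqv_nil h2, true_and]

theorem triv_commWord {T : Set (Fin 3)} {ω : Oracle} {y : Fin 8} (hy : y ≠ 0) (m : ℕ) :
    Triv T ω (commWord y m) ↔ Triv T (shift^[m] ω) (commWord y 0) := by
  induction m generalizing ω with
  | zero => rfl
  | succ m ih => rw [triv_commWord_succ hy, ih, Function.iterate_succ_apply]

/-- With `y = silentLetter k` and `z = xy = eLetter k` the commutator is `(a z a y)²`. Exactly one
of `y, z` is silent at the first symbol; its square with `a` is the only coordinate left, and that
forces silence at the next symbol too. -/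
theorem triv_commWord_zero {T : Set (Fin 3)} {ω : Oracle} (k : Fin 3) :
    Triv T ω (commWord (silentLetter k) 0) ↔
      ∃ z, (z = silentLetter k ∨ z = eLetter k) ∧ acts (ω 0) z = false ∧
        acts (ω 1) z = false ∧ Triv T (shift^[2] ω) [z] := by
  have hz : eLetter k ≠ 0 := by revert k; decide
  have hy := silentLetter_ne_zero k
  have ha : ∀ s, acts s (eLetter k) = !(acts s (silentLetter k)) := by
    intro s; revert s k; decide
  have h0 : Eqv (commWord (silentLetter k) 0)
      [0, eLetter k, 0, silentLetter k, 0, eLetter k, 0, silentLetter k] := by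
    unfold Eqv; revert k; decide
  generalize eLetter k = z at *
  generalize silentLetter k = y at *
  have hor : ∀ P : Fin 8 → Prop, (∃ t, (t = y ∨ t = z) ∧ P t) ↔ P y ∨ P z := by
    intro P
    simp only [or_and_right, exists_or, exists_eq_left]
  rw [Triv.congr h0, triv_step, hor]
  rw [show shift^[2] ω = shift (shift ω) from rfl, show ω 1 = (shift ω) 0 from rfl]
  by_cases h : acts (ω 0) y = true
  · have h1 : acts (ω 0) z = false := by rw [ha, h]; rfl
    have h2 : Triv T (shift ω) [y, y] := triv_of_eqv_nil (eqv_cancel y [])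
    simp only [sec, hy, hz, h, h1, if_true, if_false, Bool.not_false, Bool.not_true,
      Bool.false_eq_true, Bool.true_eq_false, false_and, false_or, true_and, List.nil_append,
      List.cons_append, List.append_nil, h2, and_true, ← triv_ya_sq hz]
    simp [odd, hy, hz]
  · rw [Bool.not_eq_true] at h
    have h1 : acts (ω 0) z = true := by rw [ha, h]; rfl
    have h2 : Triv T (shift ω) [z, z] := triv_of_eqv_nil (eqv_cancel z [])
    simp only [sec, hy, hz, h, h1, if_true, if_false, Bool.not_false, Bool.not_true,
      Bool.false_eq_true, Bool.true_eq_false, false_and, or_false, true_and, List.nil_append,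
      List.cons_append, List.append_nil, h2, ← triv_ay_sq hy]
    simp [odd, hy, hz]

theorem acts_eLetter (s k : Fin 3) : acts s (eLetter k) = decide (s = k) := by
  revert s k; decide

/-- `silentLetter k` is silent only at `k`, and `eLetter k` only off `k`; neither is silent on a set
that contains `k` and another symbol. On a singleton one of them always is, and this separates the
two cases. -/
theorem not_triv_commWord {T : Set (Fin 3)} (hT : T.Nontrivial) {k : Fin 3} (hk : k ∈ T)
    (ω : Oracle) (m : ℕ) : ¬ Triv T ω (commWord (silentLetter k) m) := by
  rw [triv_commWord (silentLetter_ne_zero k), triv_commWord_zero]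
  rintro ⟨z, hz, -, -, h⟩
  rcases hz with rfl | rfl
  · rw [triv_singleton (silentLetter_ne_zero k)] at h
    obtain ⟨s, hs, hsk⟩ := hT.exists_ne k
    have := h.2 s hs
    rw [acts_silentLetter] at this
    simp [hsk] at this
  · rw [triv_singleton (by clear hk h; revert k; decide)] at h
    have := h.2 k hk
    rw [acts_eLetter] at this
    simp at this

theorem triv_commWord_of_const {s : Fin 3} {ω : Oracle} {N : ℕ} (h : ∀ i, N ≤ i → ω i = s)
    (k : Fin 3) : Triv {s} ω (commWord (silentLetter k) N) := by
  rw [triv_commWord (silentLetter_ne_zero k), triv_commWord_zero]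
  have hs : ∀ i, (shift^[N] ω) i = s := fun i => by
    rw [shift_iterate]; exact h _ (Nat.le_add_right _ _)
  rw [hs 0, hs 1]
  have key : ∀ z, z ≠ 0 → acts s z = false → Triv {s} (shift^[2] (shift^[N] ω)) [z] := by
    intro z hz ha
    rw [triv_singleton hz]
    simp only [shift_iterate, mem_singleton_iff, forall_eq]
    exact ⟨fun i => by rw [h _ (Nat.le_add_right _ _), ha], ha⟩
  by_cases hk : s = k
  · have : acts s (silentLetter k) = false := by rw [acts_silentLetter]; simp [hk]
    exact ⟨_, Or.inl rfl, this, this, key _ (silentLetter_ne_zero k) this⟩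
  · have : acts s (eLetter k) = false := by rw [acts_eLetter]; simp [hk]
    exact ⟨_, Or.inr rfl, this, this, key _ (by clear hk this; revert k; decide) this⟩

/-! ## Oracles and symbols -/

theorem mem_Omega0_iff {ω : Oracle} : ω ∈ Omega0 ↔ limSymbols ω = univ := by
  rw [eq_univ_iff_forall]
  exact forall_congr' fun s => Nat.frequently_atTop_iff_infinite.symm

theorem mem_Omega2_iff {ω : Oracle} : ω ∈ Omega2 ↔ ∃ s, limSymbols ω = {s} := by
  refine exists_congr fun s => ?_
  rw [← Filter.eventually_atTop (p := fun n => ω n = s),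
    ← (admissible_limSymbols ω).1.subset_singleton_iff, limSymbols_subset_iff]
  rfl

theorem mem_Omega1_iff {ω : Oracle} :
    ω ∈ Omega1 ↔ limSymbols ω ≠ univ ∧ (limSymbols ω).Nontrivial := by
  have h := (admissible_limSymbols ω).1.exists_eq_singleton_or_nontrivial
  have h' : ∀ s, limSymbols ω = {s} → ¬ (limSymbols ω).Nontrivial := fun s hs hn => by
    rw [hs] at hn; exact not_nontrivial_singleton hn
  rw [Omega1, mem_compl_iff, mem_union, not_or, mem_Omega0_iff, mem_Omega2_iff]
  refine and_congr_right fun _ => ⟨fun h2 => h.resolve_left h2, ?_⟩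
  rintro hn ⟨s, hs⟩
  exact h' s hs hn

theorem univ_nontrivial_fin_three : (univ : Set (Fin 3)).Nontrivial :=
  ⟨0, mem_univ _, 1, mem_univ _, by decide⟩

theorem symbols_cases {T : Set (Fin 3)} (hT : T.Nonempty) :
    T = univ ∨ (∃ k, T = {k}ᶜ) ∨ ∃ s, T = {s} := by
  by_cases h1 : T = univ
  · exact Or.inl h1
  obtain ⟨k, hk⟩ := (ne_univ_iff_exists_notMem T).1 h1
  by_cases h2 : T = {k}ᶜ
  · exact Or.inr (Or.inl ⟨k, h2⟩)
  refine Or.inr (Or.inr ?_)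
  obtain ⟨s, hs⟩ := hT
  have h3 : ∃ j, j ≠ k ∧ j ∉ T := by
    by_contra! h
    refine h2 (Subset.antisymm (fun t ht => ?_) fun t ht => h t ht)
    rintro rfl
    exact hk ht
  obtain ⟨j, hjk, hj⟩ := h3
  refine ⟨s, Subset.antisymm (fun t ht => ?_) (singleton_subset_iff.2 hs)⟩
  have d1 : s ≠ k := by rintro rfl; exact hk hs
  have d2 : s ≠ j := by rintro rfl; exact hj hs
  have d3 : t ≠ k := by rintro rfl; exact hk ht
  have d4 : t ≠ j := by rintro rfl; exact hj ht
  have key : ∀ j k s t : Fin 3, j ≠ k → s ≠ k → s ≠ j → t ≠ k → t ≠ j → t = s := by decide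
  exact key j k s t hjk d1 d2 d3 d4

theorem pair_eq_compl {i j k : Fin 3} (hij : i ≠ j) (hik : i ≠ k) (hjk : j ≠ k) :
    ({i, j} : Set (Fin 3)) = {k}ᶜ := by
  ext t
  change t = i ∨ t = j ↔ ¬ t = k
  revert i j k t
  decide

theorem exists_third (i j : Fin 3) : ∃ k : Fin 3, i ≠ k ∧ j ≠ k := by revert i j; decide

theorem finite_of_notMem_limSymbols {ω : Oracle} {k : Fin 3} (h : k ∉ limSymbols ω) :
    {n | ω n = k}.Finite := by
  by_contra hf
  exact h (Nat.frequently_atTop_iff_infinite.2 hf)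

theorem Admissible.limSymbols_subset {T : Set (Fin 3)} {ω : Oracle} (h : Admissible T ω) :
    limSymbols ω ⊆ T := limSymbols_subset_iff.2 h.2

theorem Admissible.eq_of_singleton {s : Fin 3} {ω : Oracle} (h : Admissible {s} ω) :
    limSymbols ω = {s} :=
  (admissible_limSymbols ω).1.subset_singleton_iff.1 h.limSymbols_subset

theorem exists_isGroupOf {T : Set (Fin 3)} {ω : Oracle} (h : Admissible T ω) :
    ∃ M, IsGroupOf T ω M := by
  rcases symbols_cases h.1 with rfl | ⟨k, rfl⟩ | ⟨s, rfl⟩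
  · exact ⟨_, isGroupOf_alphaOvergroup ω⟩
  · exact ⟨_, isGroupOf_betaOvergroup k ω
      (finite_of_notMem_limSymbols fun hk => h.limSymbols_subset hk rfl)⟩
  · rw [← h.eq_of_singleton]
    exact ⟨_, isGroupOf_overgroup ω⟩

/-! ## Families of groups -/

/-- The groups of pairs of an oracle and an admissible set of symbols satisfying `P`. -/
def groupSet (P : Set (Fin 3) → Prop) : Set (MarkedGroup 8) :=
  {M | ∃ T ω, Admissible T ω ∧ P T ∧ IsGroupOf T ω M}

/-- On `Omega0` every symbol recurs, so α does not change the overgroup. -/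
theorem Y_eq_groupSet : Y = groupSet fun T => T = univ := by
  ext M
  constructor
  · rintro ((⟨ω, hω, rfl⟩ | ⟨ω, -, rfl⟩) | ⟨ω, -, rfl⟩)
    · exact ⟨_, ω, admissible_limSymbols ω, mem_Omega0_iff.1 hω, isGroupOf_overgroup ω⟩
    all_goals exact ⟨univ, ω, ⟨univ_nonempty, Filter.Eventually.of_forall fun _ => mem_univ _⟩,
      rfl, isGroupOf_alphaOvergroup ω⟩
  · rintro ⟨T, ω, -, rfl, hM⟩
    rw [hM.eq (isGroupOf_alphaOvergroup ω)]
    by_cases h0 : ω ∈ Omega0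
    · refine Or.inl (Or.inl ⟨ω, h0, IsGroupOf.eq ?_ (isGroupOf_alphaOvergroup ω)⟩)
      rw [← mem_Omega0_iff.1 h0]
      exact isGroupOf_overgroup ω
    by_cases h2 : ω ∈ Omega2
    · exact Or.inr ⟨ω, h2, rfl⟩
    · exact Or.inl (Or.inr ⟨ω, fun h => h.elim h0 h2, rfl⟩)

theorem X2_eq_groupSet : X2 = groupSet fun T => ∃ s, T = {s} := by
  ext M
  constructor
  · rintro ⟨ω, hω, rfl⟩
    exact ⟨_, ω, admissible_limSymbols ω, mem_Omega2_iff.1 hω, isGroupOf_overgroup ω⟩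
  · rintro ⟨T, ω, hT, ⟨s, rfl⟩, hM⟩
    have h := hT.eq_of_singleton
    refine ⟨ω, mem_Omega2_iff.2 ⟨s, h⟩, IsGroupOf.eq ?_ hM⟩
    rw [← h]
    exact isGroupOf_overgroup ω

theorem X_eq_union : X = X0 ∪ X1 ∪ X2 := by
  ext M
  constructor
  · rintro ⟨ω, rfl⟩
    by_cases h0 : ω ∈ Omega0
    · exact Or.inl (Or.inl ⟨ω, h0, rfl⟩)
    by_cases h2 : ω ∈ Omega2
    · exact Or.inr ⟨ω, h2, rfl⟩
    · exact Or.inl (Or.inr ⟨ω, fun h => h.elim h0 h2, rfl⟩)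
  · rintro ((⟨ω, -, rfl⟩ | ⟨ω, -, rfl⟩) | ⟨ω, -, rfl⟩) <;> exact ⟨ω, rfl⟩

theorem compl_nontrivial_fin_three (k : Fin 3) : ({k}ᶜ : Set (Fin 3)).Nontrivial := by
  have key : ∀ k : Fin 3, ∃ i, i ≠ k ∧ ∃ j, j ≠ k ∧ i ≠ j := by decide
  obtain ⟨i, hi, j, hj, h⟩ := key k
  exact ⟨i, hi, j, hj, h⟩

theorem union_eq_groupSet : Y ∪ X1 ∪ X2beta = groupSet Set.Nontrivial := by
  ext M
  constructor
  · rintro ((h | ⟨ω, hω, rfl⟩) | ⟨k, ω, h, -, rfl⟩)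
    · rw [Y_eq_groupSet] at h
      obtain ⟨T, ω, h1, rfl, h3⟩ := h
      exact ⟨_, ω, h1, univ_nontrivial_fin_three, h3⟩
    · exact ⟨_, ω, admissible_limSymbols ω, (mem_Omega1_iff.1 hω).2, isGroupOf_overgroup ω⟩
    · refine ⟨{k}ᶜ, ω, ⟨(compl_nontrivial_fin_three k).nonempty, ?_⟩,
        compl_nontrivial_fin_three k, isGroupOf_betaOvergroup k ω h⟩
      rw [← Nat.cofinite_eq_atTop, Filter.eventually_cofinite]
      simpa using h
  · rintro ⟨T, ω, hT, hn, hM⟩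
    rcases symbols_cases hT.1 with rfl | ⟨k, rfl⟩ | ⟨s, rfl⟩
    · refine Or.inl (Or.inl ?_)
      rw [Y_eq_groupSet]
      exact ⟨_, ω, hT, rfl, hM⟩
    · have hk : k ∉ limSymbols ω := fun hk => hT.limSymbols_subset hk rfl
      by_cases h2 : ω ∈ Omega2
      · have hf := finite_of_notMem_limSymbols hk
        exact Or.inr ⟨k, ω, hf, h2, hM.eq (isGroupOf_betaOvergroup k ω hf)⟩
      -- Two symbols recur and `k` does not, so `limSymbols ω = {k}ᶜ` and the group is the
      -- unmodified overgroup.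
      · have h0 : limSymbols ω ≠ univ := fun h => hk (h ▸ mem_univ k)
        have h1 : ω ∈ Omega1 := fun h => h.elim (fun h => h0 (mem_Omega0_iff.1 h)) h2
        have h3 := (mem_Omega1_iff.1 h1).2
        have h4 : limSymbols ω = {k}ᶜ := by
          rcases symbols_cases h3.nonempty with h | ⟨k', h⟩ | ⟨s, h⟩
          · exact absurd h h0
          · have : k = k' := by
              by_contra hne
              exact hk (by rw [h]; exact hne)
            rw [h, this]
          · rw [h] at h3
            exact absurd h3 not_nontrivial_singleton
        refine Or.inl (Or.inr ⟨ω, h1, IsGroupOf.eq ?_ hM⟩)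
        rw [← h4]
        exact isGroupOf_overgroup ω
    · exact absurd hn not_nontrivial_singleton

theorem not_isGroupOf_nontrivial_of_singleton {T : Set (Fin 3)} {s : Fin 3} {ω ω' : Oracle}
    {M : MarkedGroup 8} (hT : T.Nontrivial) (hM : IsGroupOf T ω M) (hs : Admissible {s} ω')
    (hM' : IsGroupOf {s} ω' M) : False := by
  obtain ⟨k, hk⟩ := hT.nonempty
  obtain ⟨N, hN⟩ := hs.exists_forall
  refine not_triv_commWord hT hk ω N ?_
  rw [← hM.mem_iff, hM'.mem_iff]
  exact triv_commWord_of_const hN k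

theorem agreeUpTo_of_isGroupOf {T T' : Set (Fin 3)} {ω ω' : Oracle} {M M' : MarkedGroup 8}
    {n : ℕ} (hM : IsGroupOf T ω M) (hM' : IsGroupOf T' ω' M') (hω : ∀ i < n, ω i = ω' i)
    (hT : T ∪ tailSymbols ω n = T' ∪ tailSymbols ω' n) : MarkedGroup.AgreeUpTo n M M' := by
  intro g hg
  rw [hM, hM']
  refine triv_agree hω hT ((length_reduce_le _).trans ?_)
  rw [spell, List.length_map]
  exact hg.trans Nat.lt_two_pow_self.le

/-! ## Limits -/

theorem tailSymbols_eq_insert (ω : Oracle) (N : ℕ) :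
    tailSymbols ω N = tailSymbols ω (N + 1) ∪ {ω N} := by
  ext s
  constructor
  · rintro ⟨i, hi, rfl⟩
    rcases hi.eq_or_lt with rfl | hi
    · exact Or.inr rfl
    · exact Or.inl ⟨i, hi, rfl⟩
  · rintro (⟨i, hi, rfl⟩ | rfl)
    · exact ⟨i, by omega, rfl⟩
    · exact ⟨N, le_rfl, rfl⟩

theorem exists_eventually_eq_of_finite {α β : Type*} [Finite β] (U : Ultrafilter α)
    (f : α → β) : ∃ b, ∀ᶠ a in (U : Filter α), f a = b := by
  obtain ⟨b, hb⟩ := (U.map f).eq_pure_of_finite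
  refine ⟨b, ?_⟩
  have : ({b} : Set β) ∈ U.map f := by rw [hb]; exact rfl
  exact Ultrafilter.mem_map.1 this

/-- A sequence of sets of symbols that loses at each step at most the symbol of the oracle is
given by an admissible set. -/
theorem exists_admissible {A : ℕ → Set (Fin 3)} {ω : Oracle}
    (hA : ∀ N, A N = A (N + 1) ∪ {ω N}) :
    ∃ T N₀, A N₀ = T ∧ (∀ N, N₀ ≤ N → ω N ∈ T) ∧ ∀ N, A N = T ∪ tailSymbols ω N := by
  have hanti : Antitone A := antitone_nat_of_succ_le fun N => by
    rw [hA N]; exact subset_union_left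
  obtain ⟨N₀, hN₀⟩ := WellFoundedGT.monotone_chain_condition
    (⟨fun n => OrderDual.toDual (A n), fun _ _ h => hanti h⟩ : ℕ →o (Set (Fin 3))ᵒᵈ)
  have hN : ∀ N, N₀ ≤ N → A N₀ = A N := hN₀
  have hmem : ∀ N, ω N ∈ A N := fun N => by rw [hA N]; exact Or.inr rfl
  refine ⟨A N₀, N₀, rfl, fun N h => by rw [hN N h]; exact hmem N, fun N => ?_⟩
  apply Subset.antisymm
  -- Every symbol lost after position `N` occurs in the oracle there, and from `N₀` on the sets are
  -- constant.
  · have key : ∀ k, A N ⊆ A (N + k) ∪ tailSymbols ω N := by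
      intro k
      induction k with
      | zero => exact subset_union_left
      | succ k ih =>
        refine ih.trans (union_subset ?_ subset_union_right)
        rw [hA (N + k)]
        refine union_subset subset_union_left ?_
        rintro _ rfl
        exact Or.inr ⟨N + k, by omega, rfl⟩
    have := key N₀
    rwa [← hN (N + N₀) (by omega)] at this
  · refine union_subset ?_ ?_
    · rcases le_total N N₀ with h | h
      · exact hanti h
      · exact (hN N h).subset
    · rintro _ ⟨i, hi, rfl⟩
      exact hanti hi (hmem i)

/-- Each symbol of the oracle and each set `T ∪ tailSymbols ω N` takes finitely many values, hence
has a limit along `U`. The limits obey the recursion of `exists_admissible`, and by `triv_agree` the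
resulting pair gives the limit group. The last clause yields isolation of `X2`. -/
theorem exists_ultrafilter_limit {P : Set (Fin 3) → Prop} (U : Ultrafilter (MarkedGroup 8))
    (hU : groupSet P ∈ U) :
    ∃ M, ↑U ≤ 𝓝 M ∧ ∃ T ω, Admissible T ω ∧ IsGroupOf T ω M ∧ (∃ T', P T' ∧ T' ⊆ T) ∧
      ((∃ s, T = {s}) → ∀ᶠ M' in (U : Filter _), M' = M) := by
  have hsel : ∀ M, ∃ p : Set (Fin 3) × Oracle, M ∈ groupSet P →
      Admissible p.1 p.2 ∧ P p.1 ∧ IsGroupOf p.1 p.2 M := by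
    intro M
    by_cases h : M ∈ groupSet P
    · obtain ⟨T, ω, h⟩ := h
      exact ⟨(T, ω), fun _ => h⟩
    · exact ⟨(∅, 0), fun h' => absurd h' h⟩
  choose p hp using hsel
  have hev : ∀ᶠ M in (U : Filter _), Admissible (p M).1 (p M).2 ∧ P (p M).1 ∧
      IsGroupOf (p M).1 (p M).2 M := Filter.mem_of_superset hU hp
  choose ω hω using fun N => exists_eventually_eq_of_finite U fun M => (p M).2 N
  choose A hA using fun N =>
    exists_eventually_eq_of_finite U fun M => (p M).1 ∪ tailSymbols (p M).2 N
  have hstep : ∀ N, A N = A (N + 1) ∪ {ω N} := by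
    intro N
    obtain ⟨M, h1, h2, h3⟩ := ((hA N).and ((hA (N + 1)).and (hω N))).exists
    rw [← h1, ← h2, ← h3, tailSymbols_eq_insert, union_assoc]
  obtain ⟨T, N₀, hT, hmem, hAT⟩ := exists_admissible hstep
  have hωN : ∀ N, ∀ᶠ M in (U : Filter _), ∀ i < N, ω i = (p M).2 i := fun N =>
    (Filter.eventually_all_finite (finite_lt_nat N)).2 fun i _ => (hω i).mono fun _ h => h.symm
  have hadm : Admissible T ω :=
    ⟨⟨_, hmem N₀ le_rfl⟩, Filter.eventually_atTop.2 ⟨N₀, hmem⟩⟩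
  have hsub : ∀ᶠ M in (U : Filter _), (p M).1 ⊆ T := (hA N₀).mono fun M h => by
    rw [← hT, ← h]; exact subset_union_left
  obtain ⟨M, hM⟩ := exists_isGroupOf hadm
  refine ⟨M, ?_, T, ω, hadm, hM, ?_, ?_⟩
  · intro V hV
    obtain ⟨n, hn⟩ := MarkedGroup.mem_nhds_iff_agreeUpTo.1 hV
    filter_upwards [hev, hωN n, hA n] with M' h1 h2 h3
    exact hn (agreeUpTo_of_isGroupOf hM h1.2.2 h2 (by rw [h3, hAT n]))
  · obtain ⟨M', h1, h2⟩ := (hev.and hsub).exists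
    exact ⟨_, h1.2.1, h2⟩
  · rintro ⟨s, rfl⟩
    -- Now `A N₀ = {s}`, so an approximating oracle is constantly `s` from `N₀` on and agrees with
    -- `ω` before; its set is `{s}` as well.
    filter_upwards [hev, hωN N₀, hA N₀, hsub] with M' h1 h2 h3 h4
    have h5 : (p M').1 = {s} := h1.1.1.subset_singleton_iff.1 h4
    have h6 : (p M').2 = ω := by
      funext i
      rcases lt_or_ge i N₀ with hi | hi
      · exact (h2 i hi).symm
      · have h7 : (p M').2 i ∈ ({s} : Set (Fin 3)) := by
          rw [← hT, ← h3]; exact Or.inr ⟨i, hi, rfl⟩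
        rw [mem_singleton_iff.1 h7, mem_singleton_iff.1 (hmem i hi)]
    have h8 := h1.2.2
    rw [h5, h6] at h8
    exact h8.eq hM

/-! ### Compactness of the families and isolation of the constant case -/

theorem isCompact_groupSet {P : Set (Fin 3) → Prop} (hP : ∀ T T', T ⊆ T' → P T → P T') :
    IsCompact (groupSet P) := by
  rw [isCompact_iff_ultrafilter_le_nhds]
  intro U hU
  obtain ⟨M, h1, T, ω, h2, h3, ⟨T', h4, h5⟩, -⟩ :=
    exists_ultrafilter_limit U (Filter.le_principal_iff.1 hU)
  exact ⟨M, ⟨T, ω, h2, hP T' T h5 h4, h3⟩, h1⟩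

theorem isCompact_Y : IsCompact Y := by
  rw [Y_eq_groupSet]
  exact isCompact_groupSet fun T T' h hT => univ_subset_iff.1 (hT ▸ h)

theorem isCompact_groupSet_nontrivial : IsCompact (groupSet Set.Nontrivial) :=
  isCompact_groupSet fun _ _ h hT => hT.mono h

theorem disjoint_groupSet_nontrivial_X2 : Disjoint (groupSet Set.Nontrivial) X2 := by
  rw [X2_eq_groupSet, disjoint_left]
  rintro M ⟨T, ω, -, hT, hM⟩ ⟨_, ω', h1, ⟨s, rfl⟩, h2⟩
  exact not_isGroupOf_nontrivial_of_singleton hT hM h1 h2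

theorem groupSet_true_eq : groupSet (fun _ => True) = groupSet Set.Nontrivial ∪ X2 := by
  rw [X2_eq_groupSet]
  ext M
  constructor
  · rintro ⟨T, ω, h1, -, h2⟩
    rcases h1.1.exists_eq_singleton_or_nontrivial with h | h
    · exact Or.inr ⟨T, ω, h1, h, h2⟩
    · exact Or.inl ⟨T, ω, h1, h, h2⟩
  · rintro (⟨T, ω, h1, -, h2⟩ | ⟨T, ω, h1, -, h2⟩) <;> exact ⟨T, ω, h1, trivial, h2⟩

/-- Take an ultrafilter that converges to `M` and avoids it. If the limit set were a singleton, the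
ultrafilter would eventually equal `M`; if it has two elements, `M` is not in `X2`. -/
theorem disjoint_derivedSet_X2 : Disjoint (derivedSet (groupSet fun _ => True)) X2 := by
  rw [disjoint_left]
  intro M hM hM2
  obtain ⟨U, hU⟩ := @Ultrafilter.exists_le _ _ hM
  obtain ⟨h1, h2⟩ := le_inf_iff.1 hU
  obtain ⟨M', h3, T, ω, h4, h5, -, h6⟩ :=
    exists_ultrafilter_limit U (Filter.le_principal_iff.1 h2)
  have h7 : M' = M := by
    have : Filter.NeBot (𝓝 M' ⊓ 𝓝 M) :=
      Filter.neBot_of_le (le_inf h3 (h1.trans nhdsWithin_le_nhds))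
    exact eq_of_nhds_neBot this
  subst h7
  rcases h4.1.exists_eq_singleton_or_nontrivial with h | h
  · have h8 : ∀ᶠ M in (U : Filter _), M ≠ M' := h1 self_mem_nhdsWithin
    obtain ⟨M, h9, h10⟩ := ((h6 h).and h8).exists
    exact h10 h9
  · exact disjoint_left.1 disjoint_groupSet_nontrivial_X2 ⟨T, ω, h4, h, h5⟩ hM2

/-! ## Approximation -/

-- The oracle consists of `N` symbols of `ω`, three positions that list `T` (with `s₀` in place of
-- symbols outside `T`), then `s₀ s₁`, then `τ`. The block makes the tail symbols exactly `T`; the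
-- pair `s₀ s₁` is there for the test word; `τ` fixes the type of the oracle.
open Classical in
theorem exists_splice (ω τ : Oracle) (N : ℕ) {T T' : Set (Fin 3)} (hT : T' ⊆ T) {s₀ s₁ : Fin 3}
    (h₀ : s₀ ∈ T) (h₁ : s₁ ∈ T) (hτ : ∀ n, τ n ∈ T) :
    ∃ ω' : Oracle, (∀ i < N, ω i = ω' i) ∧ T' ∪ tailSymbols ω' N = T ∧ ω' (N + 3) = s₀ ∧
      ω' (N + 3 + 1) = s₁ ∧ shift^[N + 5] ω' = τ := by
  let ω' : Oracle := fun i =>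
    if i < N then ω i else if i < N + 3 then
      (if Fin.ofNat 3 (i - N) ∈ T then Fin.ofNat 3 (i - N) else s₀)
    else if i = N + 3 then s₀ else if i = N + 4 then s₁ else τ (i - (N + 5))
  refine ⟨ω', fun i hi => by simp [ω', hi], ?_, by simp [ω'],
    by simp [ω', Nat.add_assoc], ?_⟩
  · apply Subset.antisymm
    · refine union_subset hT ?_
      rintro _ ⟨i, hi, rfl⟩
      simp only [ω', if_neg (Nat.not_lt.2 hi)]
      split_ifs with h1 h2 h3 h4
      exacts [h2, h₀, h₀, h₁, hτ _]
    · intro k hk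
      refine Or.inr ⟨N + k, Nat.le_add_right _ _, ?_⟩
      have h1 : Fin.ofNat 3 (N + k.val - N) = k := by
        rw [Nat.add_sub_cancel_left]; exact Fin.ofNat_val_eq_self k
      have h2 : N + k.val < N + 3 := by have := k.isLt; omega
      simp only [ω', if_neg (Nat.not_lt.2 (Nat.le_add_right N k)), if_pos h2, h1, if_pos hk]
  · funext i
    rw [shift_iterate]
    simp only [ω']
    rw [if_neg (by omega), if_neg (by omega), if_neg (by omega), if_neg (by omega)]
    congr 1
    omega

theorem exists_forall_union_tailSymbols {T : Set (Fin 3)} {ω : Oracle} (h : Admissible T ω)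
    (n : ℕ) : ∃ N, n ≤ N ∧ T ∪ tailSymbols ω N = T := by
  obtain ⟨N₀, hN₀⟩ := h.exists_forall
  refine ⟨max n N₀, le_max_left _ _, union_eq_self_of_subset_right ?_⟩
  rintro _ ⟨i, hi, rfl⟩
  exact hN₀ i ((le_max_right _ _).trans hi)

/-- Groups with splices `… i i τ` and `… i j τ` as oracles accumulate at any group with `i` and `j`
among its symbols. -/
theorem mem_derivedSet_of_splice {T T' : Set (Fin 3)} {ω τ : Oracle} {M : MarkedGroup 8}
    {V : Set (MarkedGroup 8)} (hadm : Admissible T ω) (hM : IsGroupOf T ω M) (hT : T' ⊆ T)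
    {i j : Fin 3} (hi : i ∈ T') (hj : j ∈ T') (hij : i ≠ j) (hτ : ∀ n, τ n ∈ T)
    (hV : ∀ ω', limSymbols ω' = limSymbols τ → ∃ M' ∈ V, IsGroupOf T' ω' M') :
    M ∈ derivedSet V := by
  rw [mem_derivedSet, accPt_iff_nhds]
  intro U hU
  obtain ⟨n, hn⟩ := MarkedGroup.mem_nhds_iff_agreeUpTo.1 hU
  obtain ⟨N, hnN, hN⟩ := exists_forall_union_tailSymbols hadm n
  have key : ∀ s ∈ T', ∃ ω' M', M' ∈ U ∩ V ∧ IsGroupOf T' ω' M' ∧ ω' (N + 3) = i ∧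
      ω' (N + 3 + 1) = s := by
    intro s hs
    obtain ⟨ω', h1, h2, h3, h4, h5⟩ := exists_splice ω τ N hT (hT hi) (hT hs) hτ
    obtain ⟨M', h6, h7⟩ := hV ω' (by rw [← h5, limSymbols_shift_iterate])
    exact ⟨ω', M', ⟨hn ((agreeUpTo_of_isGroupOf hM h7 h1 (hN.trans h2.symm)).mono hnN), h6⟩,
      h7, h3, h4⟩
  obtain ⟨ω₁, M₁, h1, h2, h3, h4⟩ := key i hi
  obtain ⟨ω₂, M₂, k1, k2, k3, k4⟩ := key j hj
  -- The test word at position `N + 3` is trivial for the continuation `i i` and not for `i j`, so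
  -- the two approximants differ and at least one is not `M`.
  by_cases h : M₁ = M
  · refine ⟨M₂, k1, fun h' => ?_⟩
    have hnt : T'.Nontrivial := ⟨i, hi, j, hj, hij⟩
    have e1 := (triv_quartic_silentLetter hnt h3).2 h4
    rw [← h2.mem_iff, h, ← h', k2.mem_iff, triv_quartic_silentLetter hnt k3, k4] at e1
    exact hij e1.symm
  · exact ⟨M₁, h1, h⟩

/-- The sequence `i j i j …` -/
def alternating (i j : Fin 3) : Oracle := fun n => if Even n then i else j

theorem limSymbols_alternating (i j : Fin 3) : limSymbols (alternating i j) = {i, j} := by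
  apply Subset.antisymm
  · refine limSymbols_subset_iff.2 (Filter.Eventually.of_forall fun n => ?_)
    unfold alternating
    split_ifs
    exacts [Or.inl rfl, Or.inr rfl]
  · rintro _ (rfl | rfl)
    · refine Filter.frequently_atTop.2 fun n => ⟨2 * n, by omega, ?_⟩
      simp [alternating]
    · refine Filter.frequently_atTop.2 fun n => ⟨2 * n + 1, by omega, ?_⟩
      simp [alternating]

theorem alternating_mem {T : Set (Fin 3)} {i j : Fin 3} (hi : i ∈ T) (hj : j ∈ T) (n : ℕ) :
    alternating i j n ∈ T := by
  unfold alternating; split_ifs <;> assumption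

theorem limSymbols_const (i : Fin 3) : limSymbols (fun _ => i) = {i} :=
  (admissible_limSymbols _).1.subset_singleton_iff.1
    (limSymbols_subset_iff.2 (Filter.Eventually.of_forall fun _ => rfl))

theorem limSymbols_ofNat : limSymbols (fun n => Fin.ofNat 3 n) = univ := by
  refine eq_univ_of_forall fun s => Filter.frequently_atTop.2 fun n => ⟨3 * n + s, by omega, ?_⟩
  ext
  have := s.isLt
  simp only [Fin.ofNat]
  omega

theorem Y_subset_derivedSet_X0 : Y ⊆ derivedSet X0 := by
  rw [Y_eq_groupSet]
  rintro M ⟨_, ω, h1, rfl, h2⟩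
  refine mem_derivedSet_of_splice (τ := fun n => Fin.ofNat 3 n) h1 h2 subset_rfl
    (mem_univ 0) (mem_univ 1) (by decide) (fun _ => mem_univ _) fun ω' hω' => ?_
  rw [limSymbols_ofNat] at hω'
  refine ⟨_, ⟨ω', mem_Omega0_iff.2 hω', rfl⟩, ?_⟩
  rw [← hω']
  exact isGroupOf_overgroup ω'

theorem pair_ne_univ {i j : Fin 3} : ({i, j} : Set (Fin 3)) ≠ univ := by
  obtain ⟨k, hik, hjk⟩ := exists_third i j
  intro h
  have : k ∈ ({i, j} : Set (Fin 3)) := h ▸ mem_univ k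
  rcases this with h | h
  exacts [hik h.symm, hjk h.symm]

theorem mem_Omega1_of_pair {ω : Oracle} {i j : Fin 3} (hij : i ≠ j)
    (h : limSymbols ω = {i, j}) : ω ∈ Omega1 := by
  rw [mem_Omega1_iff, h]
  exact ⟨pair_ne_univ, nontrivial_pair hij⟩

theorem Y_subset_derivedSet_X1alpha : Y ⊆ derivedSet X1alpha := by
  rw [Y_eq_groupSet]
  rintro M ⟨_, ω, h1, rfl, h2⟩
  have h01 : (0 : Fin 3) ≠ 1 := by decide
  refine mem_derivedSet_of_splice (τ := alternating 0 1) h1 h2 subset_rfl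
    (mem_univ 0) (mem_univ 1) h01 (fun _ => mem_univ _) fun ω' hω' => ?_
  rw [limSymbols_alternating] at hω'
  exact ⟨_, ⟨ω', mem_Omega1_of_pair h01 hω', rfl⟩, isGroupOf_alphaOvergroup ω'⟩

theorem Y_subset_derivedSet_X2alpha : Y ⊆ derivedSet X2alpha := by
  rw [Y_eq_groupSet]
  rintro M ⟨_, ω, h1, rfl, h2⟩
  refine mem_derivedSet_of_splice (τ := fun _ => 0) h1 h2 subset_rfl
    (mem_univ 0) (mem_univ 1) (by decide) (fun _ => mem_univ _) fun ω' hω' => ?_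
  rw [limSymbols_const] at hω'
  exact ⟨_, ⟨ω', mem_Omega2_iff.2 ⟨0, hω'⟩, rfl⟩, isGroupOf_alphaOvergroup ω'⟩

/-- Even when `T = univ`, a pair `T' = {i, j}` suffices: the third symbol is supplied by the finite
block of the splice, ever farther out. -/
theorem nontrivial_subset_derivedSet_X1 : groupSet Set.Nontrivial ⊆ derivedSet X1 := by
  rintro M ⟨T, ω, h1, ⟨i, hi, j, hj, hij⟩, h2⟩
  refine mem_derivedSet_of_splice (T' := {i, j}) (τ := alternating i j) h1 h2
    (pair_subset hi hj) (Or.inl rfl) (Or.inr rfl) hij (alternating_mem hi hj) fun ω' hω' => ?_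
  rw [limSymbols_alternating] at hω'
  refine ⟨_, ⟨ω', mem_Omega1_of_pair hij hω', rfl⟩, ?_⟩
  rw [← hω']
  exact isGroupOf_overgroup ω'

theorem nontrivial_subset_derivedSet_X2beta :
    groupSet Set.Nontrivial ⊆ derivedSet X2beta := by
  rintro M ⟨T, ω, h1, ⟨i, hi, j, hj, hij⟩, h2⟩
  obtain ⟨k, hik, hjk⟩ := exists_third i j
  refine mem_derivedSet_of_splice (T' := {i, j}) (τ := fun _ => i) h1 h2
    (pair_subset hi hj) (Or.inl rfl) (Or.inr rfl) hij (fun _ => hi) fun ω' hω' => ?_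
  rw [limSymbols_const] at hω'
  have hk : k ∉ limSymbols ω' := by rw [hω']; exact hik.symm
  have hf := finite_of_notMem_limSymbols hk
  refine ⟨_, ⟨k, ω', hf, mem_Omega2_iff.2 ⟨i, hω'⟩, rfl⟩, ?_⟩
  rw [pair_eq_compl hij hik hjk]
  exact isGroupOf_betaOvergroup k ω' hf

/-- The fourth-power test needs two symbols in the set, but here none is needed: the approximants
lie in `X2`, which is disjoint from the family of `M`. -/
theorem nontrivial_subset_derivedSet_X2 : groupSet Set.Nontrivial ⊆ derivedSet X2 := by
  intro M hMZ
  obtain ⟨T, ω, h1, ⟨i, hi, -⟩, h2⟩ := id hMZ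
  rw [mem_derivedSet, accPt_iff_nhds]
  intro U hU
  obtain ⟨n, hn⟩ := MarkedGroup.mem_nhds_iff_agreeUpTo.1 hU
  obtain ⟨N, hnN, hN⟩ := exists_forall_union_tailSymbols h1 n
  obtain ⟨ω', k1, k2, -, -, k5⟩ := exists_splice ω (fun _ => i) N (singleton_subset_iff.2 hi)
    hi hi fun _ => hi
  have k6 : limSymbols ω' = {i} := by
    rw [← limSymbols_const i, ← k5, limSymbols_shift_iterate]
  have k7 : overgroup ω' ∈ X2 := ⟨ω', mem_Omega2_iff.2 ⟨i, k6⟩, rfl⟩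
  have k8 := isGroupOf_overgroup ω'
  rw [k6] at k8
  refine ⟨_, ⟨hn ((agreeUpTo_of_isGroupOf h2 k8 k1 (hN.trans k2.symm)).mono hnN), k7⟩, ?_⟩
  rintro rfl
  exact disjoint_left.1 disjoint_groupSet_nontrivial_X2 hMZ k7

/-! ## Closures and limit points -/

theorem Y_subset_nontrivial : Y ⊆ groupSet Set.Nontrivial := by
  rw [← union_eq_groupSet]
  exact subset_union_left.trans subset_union_left

theorem X1_subset_nontrivial : X1 ⊆ groupSet Set.Nontrivial := by
  rw [← union_eq_groupSet]
  exact subset_union_right.trans subset_union_left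

theorem X2beta_subset_nontrivial : X2beta ⊆ groupSet Set.Nontrivial := by
  rw [← union_eq_groupSet]
  exact subset_union_right

theorem X0_subset_Y : X0 ⊆ Y := subset_union_left.trans subset_union_left

theorem X_subset_groupSet : X ⊆ groupSet fun _ => True := by
  rintro _ ⟨ω, rfl⟩
  exact ⟨_, ω, admissible_limSymbols ω, trivial, isGroupOf_overgroup ω⟩

theorem derivedSet_subset_of_isCompact {V W : Set (MarkedGroup 8)} (hW : IsCompact W)
    (h : V ⊆ W) : derivedSet V ⊆ W :=
  (derivedSet_mono V W h).trans ((isClosed_iff_derivedSet_subset W).1 hW.isClosed)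

theorem X2_subset_X : X2 ⊆ X := by
  rw [X_eq_union]; exact subset_union_right

/-- Limit points stay in the compact full family and cannot lie in `X2`; conversely `X2` alone
accumulates at every group with `|T| ≥ 2`. -/
theorem derivedSet_X : derivedSet X = groupSet Set.Nontrivial := by
  apply Subset.antisymm
  · intro M hM
    have h1 : M ∈ groupSet fun _ => True :=
      derivedSet_subset_of_isCompact (isCompact_groupSet fun _ _ _ _ => trivial)
        X_subset_groupSet hM
    rw [groupSet_true_eq] at h1
    refine h1.resolve_right fun h2 => ?_
    exact disjoint_left.1 disjoint_derivedSet_X2 (derivedSet_mono _ _ X_subset_groupSet hM) h2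
  · exact nontrivial_subset_derivedSet_X2.trans (derivedSet_mono _ _ X2_subset_X)

theorem closure_X : closure X = groupSet Set.Nontrivial ∪ X2 := by
  rw [closure_eq_self_union_derivedSet, derivedSet_X, X_eq_union]
  apply Subset.antisymm
  · rintro M (((h | h) | h) | h)
    · exact Or.inl (Y_subset_nontrivial (X0_subset_Y h))
    · exact Or.inl (X1_subset_nontrivial h)
    · exact Or.inr h
    · exact Or.inl h
  · rintro M (h | h)
    · exact Or.inr h
    · exact Or.inl (Or.inr h)

theorem isolatedPoints_eq {S : Type*} [TopologicalSpace S] (A : Set S) :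
    isolatedPoints A = A \ derivedSet A := by
  ext p
  refine and_congr_right fun hp => ?_
  rw [mem_derivedSet, accPt_iff_nhds]
  push Not
  constructor
  · rintro ⟨U, hU, h⟩
    have hpU : p ∈ U ∩ A := by rw [h]; rfl
    exact ⟨U, hU.mem_nhds hpU.1, fun y hy => by rw [h] at hy; exact hy⟩
  · rintro ⟨U, hU, h⟩
    obtain ⟨V, hVU, hV, hpV⟩ := mem_nhds_iff.1 hU
    exact ⟨V, hV, Subset.antisymm (fun y hy => h y ⟨hVU hy.1, hy.2⟩)
      (singleton_subset_iff.2 ⟨hpV, hp⟩)⟩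

theorem isolatedPoints_X : isolatedPoints X = X2 := by
  rw [isolatedPoints_eq, derivedSet_X, X_eq_union]
  apply Subset.antisymm
  · rintro M ⟨(h | h) | h, hn⟩
    · exact absurd (Y_subset_nontrivial (X0_subset_Y h)) hn
    · exact absurd (X1_subset_nontrivial h) hn
    · exact h
  · exact fun M h => ⟨Or.inr h, fun h' => disjoint_left.1 disjoint_groupSet_nontrivial_X2 h' h⟩

theorem isolatedPoints_closure_X : isolatedPoints (closure X) = X2 := by
  rw [isolatedPoints_eq, derivedSet_closure, derivedSet_X, closure_X, union_sdiff_left,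
    disjoint_groupSet_nontrivial_X2.symm.sdiff_eq_left]

theorem Y_nonempty : Y.Nonempty := by
  rw [Y_eq_groupSet]
  exact ⟨_, univ, fun _ => 0, ⟨univ_nonempty, Filter.Eventually.of_forall fun _ => mem_univ _⟩,
    rfl, isGroupOf_alphaOvergroup _⟩

end Overgroups

theorem theorem2 :
    (closure Overgroups.X = derivedSet Overgroups.X ∪ Overgroups.X2 ∧
      Disjoint (derivedSet Overgroups.X) Overgroups.X2 ∧
      Overgroups.isolatedPoints Overgroups.X = Overgroups.X2 ∧
      Overgroups.isolatedPoints (closure Overgroups.X) = Overgroups.X2) ∧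
    (Nonempty (derivedSet Overgroups.X ≃ₜ cantorSet) ∧
      Nonempty (Overgroups.Y ≃ₜ cantorSet)) ∧
    (Overgroups.Y = derivedSet Overgroups.X0 ∧
      Overgroups.Y = derivedSet Overgroups.X1alpha ∧
      Overgroups.Y = derivedSet Overgroups.X2alpha) ∧
    (derivedSet Overgroups.X = Overgroups.Y ∪ Overgroups.X1 ∪ Overgroups.X2beta ∧
      derivedSet Overgroups.X = derivedSet Overgroups.X1 ∧
      derivedSet Overgroups.X = derivedSet Overgroups.X2beta ∧
      derivedSet Overgroups.X = derivedSet Overgroups.X2) := by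
  open Overgroups in
  rw [derivedSet_X]
  refine ⟨⟨closure_X, disjoint_groupSet_nontrivial_X2, isolatedPoints_X,
    isolatedPoints_closure_X⟩, ⟨?_, ?_⟩, ⟨?_, ?_, ?_⟩, union_eq_groupSet.symm, ?_, ?_, ?_⟩
  -- Perfectness holds because the subset `X1` already accumulates at every point; `X0` plays this
  -- role for `Y`.
  · exact MarkedGroup.nonempty_homeomorph_cantorSet isCompact_groupSet_nontrivial
      (Y_nonempty.mono Y_subset_nontrivial)
      (nontrivial_subset_derivedSet_X1.trans (derivedSet_mono _ _ X1_subset_nontrivial))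
  · exact MarkedGroup.nonempty_homeomorph_cantorSet isCompact_Y Y_nonempty
      (Y_subset_derivedSet_X0.trans (derivedSet_mono _ _ X0_subset_Y))
  · exact Y_subset_derivedSet_X0.antisymm (derivedSet_subset_of_isCompact isCompact_Y X0_subset_Y)
  · exact Y_subset_derivedSet_X1alpha.antisymm (derivedSet_subset_of_isCompact isCompact_Y
      (subset_union_right.trans subset_union_left))
  · exact Y_subset_derivedSet_X2alpha.antisymm (derivedSet_subset_of_isCompact isCompact_Y
      subset_union_right)
  · exact nontrivial_subset_derivedSet_X1.antisymm
      (derivedSet_subset_of_isCompact isCompact_groupSet_nontrivial X1_subset_nontrivial)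
  · exact nontrivial_subset_derivedSet_X2beta.antisymm
      (derivedSet_subset_of_isCompact isCompact_groupSet_nontrivial X2beta_subset_nontrivial)
  · refine nontrivial_subset_derivedSet_X2.antisymm ?_
    rw [← derivedSet_X]
    exact derivedSet_mono _ _ X2_subset_X
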